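/- For a real number $0<\alpha<1$ and a positive integer $d$, let $N_\alpha(d)$ denote the maximum number of lines through the origin in $\mathbb{R}^d$ such that any two distinct ones form the angle $\arccos\alpha$ (the angle between two lines being taken in $[0,\pi/2]$). For every integer $k\ge 2$ there is an integer $d_0(k)$ such that $$N_{1/(2k-1)}(d)=\left\lfloor \frac{k}{k-1}\,(d-1)\right\rfloor\qquad\text{for all integers } d\ge d_0(k).$$ -/

import Mathlib

open scoped LinearAlgebra.Projectivization

/-- A line through the origin of `ℝ^d`, that is, a point of the projective space of `ℝ^d`. -/
abbrev OriginLine (d : ℕ) : Type := ℙ ℝ (EuclideanSpace ℝ (Fin d))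

/-- The angle, in `[0, π/2]`, between two lines through the origin: the smaller of the two
angles formed by their directions. It does not depend on the direction vectors
(see `lineAngle_mk`). -/
noncomputable def lineAngle {d : ℕ} (l m : OriginLine d) : ℝ :=
  min (InnerProductGeometry.angle l.rep m.rep) (Real.pi - InnerProductGeometry.angle l.rep m.rep)

/-- The angle between two lines may be computed with any direction vectors. -/
theorem lineAngle_mk {d : ℕ} (u v : EuclideanSpace ℝ (Fin d)) (hu : u ≠ 0) (hv : v ≠ 0) :
    lineAngle (Projectivization.mk ℝ u hu) (Projectivization.mk ℝ v hv) =
      min (InnerProductGeometry.angle u v) (Real.pi - InnerProductGeometry.angle u v) := by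
  obtain ⟨a, ha⟩ := Projectivization.exists_smul_eq_mk_rep ℝ u hu
  obtain ⟨b, hb⟩ := Projectivization.exists_smul_eq_mk_rep ℝ v hv
  unfold lineAngle
  rw [← ha, ← hb, Units.smul_def, Units.smul_def]
  rcases lt_or_gt_of_ne a.ne_zero with h1 | h1 <;> rcases lt_or_gt_of_ne b.ne_zero with h2 | h2 <;>
    simp [h1, h2, InnerProductGeometry.angle_smul_left_of_neg,
      InnerProductGeometry.angle_smul_right_of_neg, InnerProductGeometry.angle_smul_left_of_pos,
      InnerProductGeometry.angle_smul_right_of_pos, InnerProductGeometry.angle_neg_left,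
      InnerProductGeometry.angle_neg_right, min_comm]

/-- A set of lines through the origin any two distinct members of which form the
angle `arccos α`. -/
def IsEquiangular {d : ℕ} (α : ℝ) (S : Set (OriginLine d)) : Prop :=
  S.Pairwise fun l m => lineAngle l m = Real.arccos α

/-- The maximum number of lines through the origin of `ℝ^d` with pairwise angle `arccos α`.
As the supremum is taken in `ℕ∞`, a finite value is attained. -/
noncomputable def maxEquiangular (α : ℝ) (d : ℕ) : ℕ∞ :=
  ⨆ (S : Set (OriginLine d)) (_ : IsEquiangular α S), S.encard

/-! Unit vectors with inner products ±1/(2k-1) have Gram matrix proportional to M = (k-1)I - A +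
J/2, where A is the adjacency matrix of the graph of negative products and J is the all-ones matrix.
M is positive semidefinite of rank at most d, so n lines satisfy n ≤ d + corank M, and the upper
bound is a bound on this corank.

Replacing some vectors by their negatives makes all degrees bounded in terms of k, unless n itself
is bounded (`exists_switching_bounded_degree`). If (k-1)I - A is positive semidefinite, the kernel
of M is the sum-zero part of the eigenspace of k-1. By Perron–Frobenius a component contributes at
most one dimension to that eigenspace, and only if it has at least k vertices; the sum-zero
condition costs one more. So a nonzero corank is at most n/k - 1, which gives exactly k(d-1)/(k-1).

Otherwise A has an eigenvalue above k-1. Since J has rank one, all eigenvectors for k-1 then live in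
one component (`false_of_two_nonpos`). Delete from it a sparse net and the boundedly many vertices
around which A is already too large. Counts of closed walks at the remaining vertices decay relative
to powers of k-1, so a high power of the adjacency matrix bounds the multiplicity by a small
fraction of n plus a constant (`finrank_eigenspace_le_of_quadForm_neg`). For large d this case falls
below the bound.

Conversely, disjoint regular simplices with k vertices, raised by a common extra coordinate, attain
the bound (`le_maxEquiangular`). -/

/-! ### The quadratic form of cI - A and its null vectors -/

section QuadraticForm

open scoped Classical
open Matrix

variable {V : Type*} [Fintype V]

/-- The quadratic form of the matrix `c I - A`, where `A` is the adjacency matrix of `G`. -/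
noncomputable def quadForm (G : SimpleGraph V) (c : ℝ) (x : V → ℝ) : ℝ :=
  c * (x ⬝ᵥ x) - x ⬝ᵥ (G.adjMatrix ℝ *ᵥ x)

/-- The subgraph of `G` on the same vertices keeping only the edges inside `s`. -/
def SimpleGraph.edgesWithin {V : Type*} (G : SimpleGraph V) (s : Set V) : SimpleGraph V where
  Adj u v := G.Adj u v ∧ u ∈ s ∧ v ∈ s
  symm := ⟨fun _ _ h => ⟨h.1.symm, h.2.2, h.2.1⟩⟩
  loopless := ⟨fun _ h => h.1.ne rfl⟩

@[simp] theorem SimpleGraph.edgesWithin_adj {V : Type*} (G : SimpleGraph V) (s : Set V) (u v : V) :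
    (G.edgesWithin s).Adj u v ↔ G.Adj u v ∧ u ∈ s ∧ v ∈ s := Iff.rfl

theorem adjMatrix_nonneg {V : Type*} (G : SimpleGraph V) (u v : V) : 0 ≤ G.adjMatrix ℝ u v := by
  rw [SimpleGraph.adjMatrix_apply]; split_ifs <;> norm_num

theorem dotProduct_adjMatrix_comm (G : SimpleGraph V) (x y : V → ℝ) :
    x ⬝ᵥ (G.adjMatrix ℝ *ᵥ y) = y ⬝ᵥ (G.adjMatrix ℝ *ᵥ x) := by
  rw [dotProduct_mulVec, dotProduct_comm, ← mulVec_transpose, SimpleGraph.transpose_adjMatrix]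

theorem dotProduct_adjMatrix_eq_sum (G : SimpleGraph V) (x y : V → ℝ) :
    x ⬝ᵥ (G.adjMatrix ℝ *ᵥ y) = ∑ u, ∑ v, x u * (G.adjMatrix ℝ u v * y v) := by
  simp only [dotProduct, mulVec, Finset.mul_sum]

theorem abs_dotProduct_adjMatrix_le (G : SimpleGraph V) (x : V → ℝ) :
    |x ⬝ᵥ (G.adjMatrix ℝ *ᵥ x)| ≤ |x| ⬝ᵥ (G.adjMatrix ℝ *ᵥ |x|) := by
  rw [dotProduct_adjMatrix_eq_sum, dotProduct_adjMatrix_eq_sum]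
  refine (Finset.abs_sum_le_sum_abs _ _).trans (Finset.sum_le_sum fun u _ => ?_)
  refine (Finset.abs_sum_le_sum_abs _ _).trans (Finset.sum_le_sum fun v _ => ?_)
  rw [abs_mul, abs_mul, abs_of_nonneg (adjMatrix_nonneg G u v)]
  simp [Pi.abs_apply]

theorem abs_dotProduct_abs (x : V → ℝ) : |x| ⬝ᵥ |x| = x ⬝ᵥ x := by
  simp [dotProduct, Pi.abs_apply]

/-- The variational core of Perron–Frobenius: absolute values keep the norm and, as A has
nonnegative entries, can only raise the term xᵀAx. -/
theorem quadForm_abs_le (G : SimpleGraph V) (c : ℝ) (x : V → ℝ) :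
    quadForm G c |x| ≤ quadForm G c x := by
  unfold quadForm
  rw [abs_dotProduct_abs]
  linarith [abs_dotProduct_adjMatrix_le G x, le_abs_self (x ⬝ᵥ (G.adjMatrix ℝ *ᵥ x))]

theorem quadForm_eq_sum (G : SimpleGraph V) (c : ℝ) (x : V → ℝ) :
    quadForm G c x = ∑ v, x v * (c * x v - (G.adjMatrix ℝ *ᵥ x) v) := by
  simp only [quadForm, dotProduct, Finset.mul_sum, ← Finset.sum_sub_distrib]
  exact Finset.sum_congr rfl fun v _ => by ring

theorem quadForm_smul_sub_smul (G : SimpleGraph V) (c a b : ℝ) (u w : V → ℝ) :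
    quadForm G c (a • u - b • w) = a ^ 2 * quadForm G c u + b ^ 2 * quadForm G c w
      - 2 * a * b * (c * (u ⬝ᵥ w) - u ⬝ᵥ (G.adjMatrix ℝ *ᵥ w)) := by
  have h1 := dotProduct_adjMatrix_comm G w u
  have h2 := dotProduct_comm w u
  simp only [quadForm, sub_dotProduct, dotProduct_sub, mulVec_sub, mulVec_smul, smul_dotProduct,
    dotProduct_smul, smul_eq_mul, h1, h2]
  ring

/-- If `c I - A + J / 2` is positive semidefinite, two nonnegative vectors with non-adjacent
disjoint supports cannot both witness that `c I - A` fails to be positive definite, one of them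
strictly. -/
theorem false_of_two_nonpos (G : SimpleGraph V) (c : ℝ)
    (hM : ∀ x, 0 ≤ quadForm G c x + (∑ v, x v) ^ 2 / 2) (u w : V → ℝ) (hw : 0 ≤ w)
    (hw0 : w ≠ 0) (hun : quadForm G c u < 0) (hwn : quadForm G c w ≤ 0)
    (hdot : ∀ v, u v * w v = 0) (hadj : ∀ v v', G.Adj v v' → u v * w v' = 0) : False := by
  have hsw : 0 < ∑ v, w v := by
    obtain ⟨v, hv⟩ := Function.ne_iff.1 hw0
    exact Finset.sum_pos' (fun i _ => hw i) ⟨v, Finset.mem_univ v, lt_of_le_of_ne (hw v) hv.symm⟩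
  have h0 : u ⬝ᵥ w = 0 := Finset.sum_eq_zero fun v _ => hdot v
  have h1 : u ⬝ᵥ (G.adjMatrix ℝ *ᵥ w) = 0 := by
    rw [dotProduct_adjMatrix_eq_sum]
    refine Finset.sum_eq_zero fun v _ => Finset.sum_eq_zero fun v' _ => ?_
    rw [SimpleGraph.adjMatrix_apply]
    split_ifs with h
    · rw [one_mul, hadj v v' h]
    · simp
  -- This combination has coordinate sum zero, so the J term vanishes and only the two nonpositive
  -- forms remain.
  have h2 := hM ((∑ v, w v) • u - (∑ v, u v) • w)
  have h3 : ∑ v, ((∑ v, w v) • u - (∑ v, u v) • w) v = 0 := by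
    simp only [Pi.sub_apply, Pi.smul_apply, smul_eq_mul, Finset.sum_sub_distrib, ← Finset.mul_sum]
    ring
  rw [h3, quadForm_smul_sub_smul, h0, h1] at h2
  nlinarith [mul_pos hsw hsw, sq_nonneg (∑ v, u v), mul_pos (mul_pos hsw hsw) (neg_pos.2 hun),
    mul_nonneg (sq_nonneg (∑ v, u v)) (neg_nonneg.2 hwn)]

theorem mulVec_eq_of_quadForm_eq_zero (G : SimpleGraph V) (c : ℝ)
    (hpsd : ∀ x, 0 ≤ quadForm G c x) (x : V → ℝ) (hx : quadForm G c x ≤ 0) :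
    G.adjMatrix ℝ *ᵥ x = c • x := by
  set z := G.adjMatrix ℝ *ᵥ x - c • x with hz
  by_contra hne
  have hzz : 0 < z ⬝ᵥ z := by
    have h0 : z ≠ 0 := fun h => hne (sub_eq_zero.1 h)
    have := dotProduct_self_eq_zero (v := z)
    have h1 : 0 ≤ z ⬝ᵥ z := Finset.sum_nonneg fun i _ => mul_self_nonneg _
    exact lt_of_le_of_ne h1 fun h => h0 (this.1 h.symm)
  have hcross : c * (x ⬝ᵥ z) - x ⬝ᵥ (G.adjMatrix ℝ *ᵥ z) = -(z ⬝ᵥ z) := by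
    rw [dotProduct_adjMatrix_comm, dotProduct_comm x z]
    conv_rhs => rw [hz, dotProduct_sub, ← hz, dotProduct_smul, smul_eq_mul]
    ring
  have hQz := hpsd z
  set q := quadForm G c z
  -- A small move from x along the residual z would make the form negative. Dividing by q + 1
  -- instead of q covers q = 0.
  have h := hpsd ((1 : ℝ) • x - (-(z ⬝ᵥ z) / (q + 1)) • z)
  rw [quadForm_smul_sub_smul, hcross] at h
  have hx0 : quadForm G c x = 0 := le_antisymm hx (hpsd x)
  rw [hx0] at h
  have h5 : (-(z ⬝ᵥ z) / (q + 1)) ^ 2 * q - 2 * 1 * (-(z ⬝ᵥ z) / (q + 1)) * (-(z ⬝ᵥ z))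
      = (z ⬝ᵥ z) ^ 2 / (q + 1) * (q / (q + 1) - 2) := by
    field_simp
  have h6 : q / (q + 1) < 1 := by rw [div_lt_one (by linarith)]; linarith
  have h7 : 0 < (z ⬝ᵥ z) ^ 2 / (q + 1) := by positivity
  nlinarith [mul_pos h7 (show 0 < 2 - q / (q + 1) by linarith)]

theorem mulVec_abs_eq_of_mulVec_eq (G : SimpleGraph V) (c : ℝ)
    (hpsd : ∀ x, 0 ≤ quadForm G c x) (x : V → ℝ) (hx : G.adjMatrix ℝ *ᵥ x = c • x) :
    G.adjMatrix ℝ *ᵥ |x| = c • |x| := by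
  refine mulVec_eq_of_quadForm_eq_zero G c hpsd _ ((quadForm_abs_le G c x).trans ?_)
  simp [quadForm, hx, dotProduct_smul]

/-- Both cI - A and cI + A are positive semidefinite. Evaluating them at (c + A)x and (c - A)x and
adding gives 2c xᵀ(c² - A²)x ≥ 0. -/
theorem dotProduct_mulVec_self_le (G : SimpleGraph V) (c : ℝ) (hc : 0 < c)
    (hpsd : ∀ x, 0 ≤ quadForm G c x) (x : V → ℝ) :
    (G.adjMatrix ℝ *ᵥ x) ⬝ᵥ (G.adjMatrix ℝ *ᵥ x) ≤ c ^ 2 * (x ⬝ᵥ x) := by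
  have hneg : ∀ y : V → ℝ, 0 ≤ c * (y ⬝ᵥ y) + y ⬝ᵥ (G.adjMatrix ℝ *ᵥ y) := fun y => by
    have h1 := hpsd |y|
    unfold quadForm at h1
    rw [abs_dotProduct_abs] at h1
    linarith [abs_dotProduct_adjMatrix_le G y, neg_abs_le (y ⬝ᵥ (G.adjMatrix ℝ *ᵥ y))]
  set z := G.adjMatrix ℝ *ᵥ x with hz
  have h1 := hneg (c • x - z)
  have h2 := hpsd (c • x + z)
  have h3 := dotProduct_comm z x
  have h4 := dotProduct_adjMatrix_comm G x z
  simp only [quadForm, sub_dotProduct, dotProduct_sub, add_dotProduct, dotProduct_add, mulVec_add,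
    mulVec_sub, mulVec_smul, smul_dotProduct, dotProduct_smul, smul_eq_mul, h3, h4, ← hz] at h1 h2
  nlinarith

theorem quadForm_edgesWithin_nonneg (G : SimpleGraph V) (c : ℝ) (hc : 0 ≤ c) (s : Set V)
    (h : ∀ x : V → ℝ, (∀ v ∉ s, x v = 0) → 0 ≤ quadForm G c x) (x : V → ℝ) :
    0 ≤ quadForm (G.edgesWithin s) c x := by
  have h1 := h (s.indicator x) fun v hv => Set.indicator_of_notMem hv x
  have h2 : s.indicator x ⬝ᵥ (G.adjMatrix ℝ *ᵥ s.indicator x) =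
      x ⬝ᵥ ((G.edgesWithin s).adjMatrix ℝ *ᵥ x) := by
    rw [dotProduct_adjMatrix_eq_sum, dotProduct_adjMatrix_eq_sum]
    refine Finset.sum_congr rfl fun u _ => Finset.sum_congr rfl fun v _ => ?_
    simp only [SimpleGraph.adjMatrix_apply, SimpleGraph.edgesWithin_adj, Set.indicator_apply]
    by_cases hu : u ∈ s <;> by_cases hv : v ∈ s <;> simp [hu, hv]
  have h3 : s.indicator x ⬝ᵥ s.indicator x ≤ x ⬝ᵥ x := by
    refine Finset.sum_le_sum fun v _ => ?_
    rw [Set.indicator_apply]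
    split_ifs
    · exact le_rfl
    · simpa using mul_self_nonneg (x v)
  unfold quadForm at h1 ⊢
  rw [h2] at h1
  nlinarith [mul_le_mul_of_nonneg_left h3 hc]

/-- A set of vertices closed under adjacency splits off its part of the quadratic form. -/
theorem quadForm_indicator (G : SimpleGraph V) (c : ℝ) (s : Set V)
    (hs : ∀ u v, G.Adj u v → u ∈ s → v ∈ s) (x : V → ℝ) :
    quadForm G c (s.indicator x) =
      ∑ v, s.indicator (fun v => x v * (c * x v - (G.adjMatrix ℝ *ᵥ x) v)) v := by
  rw [quadForm_eq_sum]
  refine Finset.sum_congr rfl fun v _ => ?_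
  by_cases hv : v ∈ s
  · have : (G.adjMatrix ℝ *ᵥ s.indicator x) v = (G.adjMatrix ℝ *ᵥ x) v := by
      refine Finset.sum_congr rfl fun u _ => ?_
      simp only [SimpleGraph.adjMatrix_apply]
      split_ifs with h
      · rw [Set.indicator_of_mem (hs v u h hv)]
      · simp
    simp [hv, this]
  · simp [hv]

end QuadraticForm

/-! ### Dimension counts and the Frobenius bound on multiplicity -/

section LinearAlgebraBounds

open Matrix

/-- Imposing the vanishing of a linear map lowers the dimension by at most the dimension of the
target. -/
theorem Submodule.finrank_le_finrank_inf_ker_add {E F : Type*} [AddCommGroup E] [Module ℝ E]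
    [FiniteDimensional ℝ E] [AddCommGroup F] [Module ℝ F] [FiniteDimensional ℝ F]
    (W : Submodule ℝ E) (f : E →ₗ[ℝ] F) :
    Module.finrank ℝ W ≤
      Module.finrank ℝ (W ⊓ LinearMap.ker f : Submodule ℝ E) + Module.finrank ℝ F := by
  have h1 := LinearMap.finrank_range_add_finrank_ker (f.domRestrict W)
  have h2 : Module.finrank ℝ (LinearMap.range (f.domRestrict W)) ≤ Module.finrank ℝ F :=
    Submodule.finrank_le _
  have h3 : (LinearMap.ker (f.domRestrict W)).map W.subtype = W ⊓ LinearMap.ker f := by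
    ext x
    simp only [Submodule.mem_map, LinearMap.mem_ker, LinearMap.domRestrict_apply, Submodule.mem_inf,
      Submodule.subtype_apply]
    constructor
    · rintro ⟨y, hy, rfl⟩
      exact ⟨y.2, hy⟩
    · rintro ⟨hx, hfx⟩
      exact ⟨⟨x, hx⟩, hfx, rfl⟩
  have h4 := Submodule.finrank_map_subtype_eq W (LinearMap.ker (f.domRestrict W))
  rw [h3] at h4
  omega

/-- Vectors of a subspace that vanish on a finite set of coordinates. -/
theorem Submodule.finrank_le_finrank_inf_vanishing_add {V : Type*} [Fintype V]
    (W : Submodule ℝ (V → ℝ)) (F : Finset V) :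
    ∃ W' : Submodule ℝ (V → ℝ), W' ≤ W ∧ (∀ x ∈ W', ∀ v ∈ F, x v = 0) ∧
      Module.finrank ℝ W ≤ Module.finrank ℝ W' + F.card := by
  refine ⟨W ⊓ LinearMap.ker (LinearMap.funLeft ℝ ℝ (Subtype.val : F → V)), inf_le_left, ?_,
    (W.finrank_le_finrank_inf_ker_add (LinearMap.funLeft ℝ ℝ (Subtype.val : F → V))).trans ?_⟩
  · rintro x ⟨-, hx⟩ v hv
    exact congrFun (LinearMap.mem_ker.1 hx) ⟨v, hv⟩
  · simp

/-- The dimension of an eigenspace of a matrix, weighted by the squared eigenvalue, is at most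
the squared Frobenius norm of the matrix. -/
theorem finrank_mul_sq_le_of_eigenspace {V : Type*} [Fintype V] (T : Matrix V V ℝ)
    (c : ℝ) (W : Submodule ℝ (V → ℝ)) (hW : ∀ x ∈ W, T *ᵥ x = c • x) :
    (Module.finrank ℝ W : ℝ) * c ^ 2 ≤ ∑ v, T.row v ⬝ᵥ T.row v := by
  let e := (WithLp.linearEquiv 2 ℝ (V → ℝ))
  let W' : Submodule ℝ (EuclideanSpace ℝ V) := W.comap e.toLinearMap
  have hfr : Module.finrank ℝ W' = Module.finrank ℝ W := by
    have : W'.map e.toLinearMap = W := Submodule.map_comap_eq_of_surjective e.surjective W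
    rw [← this]
    exact (LinearEquiv.finrank_map_eq e W').symm
  let b := stdOrthonormalBasis ℝ W'
  have horth : Orthonormal ℝ (fun i => (b i : EuclideanSpace ℝ V)) :=
    b.orthonormal.comp_linearIsometry W'.subtypeₗᵢ
  -- Bessel's inequality for row v: its inner product with the eigenvector b i is c times the entry
  -- of b i at v.
  have key : ∀ v, ∑ i, (c * (b i : EuclideanSpace ℝ V) v) ^ 2 ≤ T.row v ⬝ᵥ T.row v := by
    intro v
    have h1 := horth.sum_inner_products_le (s := Finset.univ)
      (WithLp.toLp 2 (T.row v) : EuclideanSpace ℝ V)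
    rw [EuclideanSpace.norm_sq_eq] at h1
    refine le_trans (le_of_eq ?_) (h1.trans (le_of_eq ?_))
    · refine Finset.sum_congr rfl fun i _ => ?_
      have h2 := congrFun (hW (e (b i)) (b i).2) v
      rw [Real.norm_eq_abs, sq_abs, PiLp.inner_apply]
      congr 1
      exact h2.symm
    · exact Finset.sum_congr rfl fun w _ => by simp [sq]
  calc (Module.finrank ℝ W : ℝ) * c ^ 2
      = ∑ i : Fin (Module.finrank ℝ W'), c ^ 2 * ‖(b i : EuclideanSpace ℝ V)‖ ^ 2 := by
        simp [horth.1, hfr]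
    _ = ∑ i, ∑ v, (c * (b i : EuclideanSpace ℝ V) v) ^ 2 := by
        refine Finset.sum_congr rfl fun i _ => ?_
        rw [EuclideanSpace.norm_sq_eq, Finset.mul_sum]
        exact Finset.sum_congr rfl fun v _ => by rw [Real.norm_eq_abs, sq_abs, mul_pow]
    _ = ∑ v, ∑ i, (c * (b i : EuclideanSpace ℝ V) v) ^ 2 := Finset.sum_comm
    _ ≤ _ := Finset.sum_le_sum fun v _ => key v

end LinearAlgebraBounds

/-! ### Multiplicity of k - 1 when it is the largest possible eigenvalue -/

section PositiveSemidefinite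

open scoped Classical
open Matrix

variable {V : Type*} [Fintype V]

theorem eq_zero_of_adj_of_nonneg (G : SimpleGraph V) (c : ℝ) (y : V → ℝ) (hy : 0 ≤ y)
    (h : G.adjMatrix ℝ *ᵥ y = c • y) (u v : V) (huv : G.Adj u v) (hu : y u = 0) : y v = 0 := by
  have h1 := congrFun h u
  rw [SimpleGraph.adjMatrix_mulVec_apply, Pi.smul_apply, hu, smul_zero] at h1
  exact (Finset.sum_eq_zero_iff_of_nonneg fun i _ => hy i).1 h1 v (by simpa using huv)

theorem eq_zero_of_reachable_of_nonneg (G : SimpleGraph V) (c : ℝ) (y : V → ℝ) (hy : 0 ≤ y)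
    (h : G.adjMatrix ℝ *ᵥ y = c • y) (u v : V) (huv : G.Reachable u v) (hu : y u = 0) :
    y v = 0 := by
  obtain ⟨p⟩ := huv
  induction p with
  | nil => exact hu
  | cons hadj _ ih => exact ih (eq_zero_of_adj_of_nonneg G c y hy h _ _ hadj hu)

/-- A component carrying a nonnegative eigenvector of eigenvalue `c` has more than `c` vertices. -/
theorem le_card_component (G : SimpleGraph V) (k : ℕ) (y : V → ℝ) (hy : 0 ≤ y)
    (h : G.adjMatrix ℝ *ᵥ y = ((k : ℝ) - 1) • y) (C : G.ConnectedComponent)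
    (hC : ∃ v, G.connectedComponentMk v = C ∧ y v ≠ 0) :
    k ≤ (Finset.univ.filter fun v => G.connectedComponentMk v = C).card := by
  obtain ⟨v₀, hv₀, hy₀⟩ := hC
  -- At a maximum of y on the component, the eigenvalue equation forces at least k - 1 neighbours.
  obtain ⟨v, hv, hmax⟩ := Finset.exists_max_image
    (Finset.univ.filter fun v => G.connectedComponentMk v = C) y ⟨v₀, by simpa using hv₀⟩
  have hvC : G.connectedComponentMk v = C := by simpa using hv
  have hpos : 0 < y v :=
    lt_of_lt_of_le (lt_of_le_of_ne (hy v₀) hy₀.symm) (hmax v₀ (by simpa using hv₀))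
  have hsub : insert v (G.neighborFinset v) ⊆
      Finset.univ.filter fun v => G.connectedComponentMk v = C := by
    intro u hu
    rcases Finset.mem_insert.1 hu with rfl | hu
    · exact hv
    · have hadj : G.Adj v u := by simpa using hu
      simpa [← hvC] using hadj.symm.reachable
  have h1 := congrFun h v
  rw [SimpleGraph.adjMatrix_mulVec_apply, Pi.smul_apply, smul_eq_mul] at h1
  have h2 : ∑ u ∈ G.neighborFinset v, y u ≤ (G.neighborFinset v).card • y v :=
    Finset.sum_le_card_nsmul _ _ _ fun u hu => hmax u (hsub (Finset.mem_insert_of_mem hu))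
  rw [h1, nsmul_eq_mul] at h2
  have h3 : (k : ℝ) - 1 ≤ (G.neighborFinset v).card := le_of_mul_le_mul_right h2 hpos
  have h4 : k ≤ (G.neighborFinset v).card + 1 := by
    have : (k : ℝ) ≤ (G.neighborFinset v).card + 1 := by linarith
    exact_mod_cast this
  have h5 := Finset.card_le_card hsub
  rw [Finset.card_insert_of_notMem (by simp)] at h5
  omega

/-- Evaluation at one vertex of each component met by the eigenspace is injective: if x vanishes
there, so does the nonnegative eigenvector |x|, and its zeros spread over the component. Each such
component has at least k vertices. -/
theorem finrank_eigenspace_mul_le (G : SimpleGraph V) (k : ℕ)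
    (hpsd : ∀ x, 0 ≤ quadForm G ((k : ℝ) - 1) x) (E : Submodule ℝ (V → ℝ))
    (hE : ∀ x ∈ E, G.adjMatrix ℝ *ᵥ x = ((k : ℝ) - 1) • x) :
    k * Module.finrank ℝ E ≤ Fintype.card V := by
  let T : Finset G.ConnectedComponent := Finset.univ.filter fun C =>
    ∃ x ∈ E, ∃ v, G.connectedComponentMk v = C ∧ x v ≠ 0
  let f : E →ₗ[ℝ] (T → ℝ) :=
    (LinearMap.funLeft ℝ ℝ (fun C : T => C.1.out)).comp E.subtype
  have hinj : Function.Injective f := by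
    rw [← LinearMap.ker_eq_bot, LinearMap.ker_eq_bot']
    rintro ⟨x, hx⟩ hfx
    have habs := mulVec_abs_eq_of_mulVec_eq G _ hpsd x (hE x hx)
    ext v
    by_contra hv
    have hmem : G.connectedComponentMk v ∈ T := by
      simp only [T, Finset.mem_filter, Finset.mem_univ, true_and]
      exact ⟨x, hx, v, rfl, hv⟩
    have h0 : x (G.connectedComponentMk v).out = 0 := congrFun hfx ⟨_, hmem⟩
    have hreach : G.Reachable (G.connectedComponentMk v).out v :=
      SimpleGraph.ConnectedComponent.exact (Quot.out_eq (G.connectedComponentMk v))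
    have := eq_zero_of_reachable_of_nonneg G _ |x| (abs_nonneg x) habs _ v hreach (by simp [h0])
    exact hv (by simpa using this)
  have h1 : Module.finrank ℝ E ≤ T.card := by
    have := LinearMap.finrank_le_finrank_of_injective hinj
    simpa using this
  have h2 : ∀ C ∈ T, k ≤ (Finset.univ.filter fun v => G.connectedComponentMk v = C).card := by
    intro C hC
    obtain ⟨x, hx, v, hv, hxv⟩ := (Finset.mem_filter.1 hC).2
    exact le_card_component G k |x| (abs_nonneg x)
      (mulVec_abs_eq_of_mulVec_eq G _ hpsd x (hE x hx)) C ⟨v, hv, by simpa using hxv⟩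
  have h3 : T.card * k ≤ Fintype.card V := by
    calc T.card * k ≤ ∑ C ∈ T, (Finset.univ.filter fun v => G.connectedComponentMk v = C).card := by
          simpa using Finset.card_nsmul_le_sum T _ k h2
      _ ≤ ∑ C, (Finset.univ.filter fun v => G.connectedComponentMk v = C).card :=
          Finset.sum_le_sum_of_subset (Finset.subset_univ _)
      _ = Fintype.card V := by
          rw [← Finset.card_univ]
          exact (Finset.card_eq_sum_card_fiberwise (fun v _ => Finset.mem_univ _)).symm
  calc k * Module.finrank ℝ E ≤ k * T.card := Nat.mul_le_mul_left k h1
    _ ≤ _ := by rwa [mul_comm]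

/-- If `(k - 1) I - A` is positive semidefinite, the eigenspace of `k - 1` meets the sum-zero
hyperplane in dimension zero or at most `n / k - 1`. -/
theorem finrank_sum_zero_eigenspace_le (G : SimpleGraph V) (k : ℕ)
    (hpsd : ∀ x, 0 ≤ quadForm G ((k : ℝ) - 1) x) (W : Submodule ℝ (V → ℝ))
    (hW : ∀ x ∈ W, G.adjMatrix ℝ *ᵥ x = ((k : ℝ) - 1) • x ∧ ∑ v, x v = 0) :
    Module.finrank ℝ W = 0 ∨ k * (Module.finrank ℝ W + 1) ≤ Fintype.card V := by
  let E : Submodule ℝ (V → ℝ) :=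
    LinearMap.ker ((G.adjMatrix ℝ).mulVecLin - ((k : ℝ) - 1) • LinearMap.id)
  have hmemE : ∀ x, x ∈ E ↔ G.adjMatrix ℝ *ᵥ x = ((k : ℝ) - 1) • x := fun x => by
    simp [E, sub_eq_zero]
  by_cases hW0 : W = ⊥
  · left; simp [hW0]
  right
  -- If the two were equal, a nonzero x in `W` would put |x| in `W`, but the entries of |x| cannot
  -- sum to zero.
  have hWE : W < E := by
    refine lt_of_le_of_ne (fun x hx => (hmemE x).2 (hW x hx).1) fun heq => hW0 ?_
    rw [Submodule.eq_bot_iff]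
    intro x hx
    have hy : |x| ∈ W := by
      rw [heq, hmemE]
      exact mulVec_abs_eq_of_mulVec_eq G _ hpsd x (hW x hx).1
    have h := (hW _ hy).2
    rw [Finset.sum_eq_zero_iff_of_nonneg fun i _ => by simp] at h
    ext v
    simpa using h v (Finset.mem_univ v)
  have h1 := Submodule.finrank_lt_finrank_of_lt hWE
  exact (Nat.mul_le_mul_left k h1).trans
    (finrank_eigenspace_mul_le G k hpsd E fun x hx => (hmemE x).1 hx)

end PositiveSemidefinite

/-! ### Decay of closed walk counts after deleting a net -/

section LocalDecay

open scoped Classical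
open Matrix

variable {V : Type*}

/-- `u` and `v` are joined by a walk of length at most `R`. -/
def SimpleGraph.WithinDist (G : SimpleGraph V) (R : ℕ) (u v : V) : Prop :=
  ∃ p : G.Walk u v, p.length ≤ R

theorem SimpleGraph.WithinDist.refl (G : SimpleGraph V) (R : ℕ) (u : V) : G.WithinDist R u u :=
  ⟨.nil, Nat.zero_le _⟩

theorem SimpleGraph.WithinDist.symm {G : SimpleGraph V} {R : ℕ} {u v : V}
    (h : G.WithinDist R u v) : G.WithinDist R v u :=
  let ⟨p, hp⟩ := h
  ⟨p.reverse, by rwa [p.length_reverse]⟩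

theorem SimpleGraph.WithinDist.trans {G : SimpleGraph V} {R S : ℕ} {u v w : V}
    (h : G.WithinDist R u v) (h' : G.WithinDist S v w) : G.WithinDist (R + S) u w :=
  let ⟨p, hp⟩ := h
  let ⟨q, hq⟩ := h'
  ⟨p.append q, by rw [SimpleGraph.Walk.length_append]; omega⟩

theorem SimpleGraph.WithinDist.mono {G : SimpleGraph V} {R S : ℕ} {u v : V}
    (h : G.WithinDist R u v) (hRS : R ≤ S) : G.WithinDist S u v :=
  let ⟨p, hp⟩ := h
  ⟨p, hp.trans hRS⟩

theorem SimpleGraph.Adj.withinDist {G : SimpleGraph V} {u v : V} (h : G.Adj u v) :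
    G.WithinDist 1 u v :=
  ⟨.cons h .nil, by simp⟩

theorem SimpleGraph.Walk.exists_edgesWithin_of_withinDist {G : SimpleGraph V} {R : ℕ} {v : V}
    {u w : V} (p : G.Walk u w) (m : ℕ) (hm : G.WithinDist m v u) (h : p.length + m ≤ R) :
    ∃ q : (G.edgesWithin {z | G.WithinDist R v z}).Walk u w, q.length = p.length := by
  induction p generalizing m with
  | nil => exact ⟨.nil, rfl⟩
  | @cons a b _ hadj p ih =>
    rw [SimpleGraph.Walk.length_cons] at h
    have hb : G.WithinDist (m + 1) v b := hm.trans hadj.withinDist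
    obtain ⟨q, hq⟩ := ih (m + 1) hb (by omega)
    have hab : (G.edgesWithin {z | G.WithinDist R v z}).Adj a b :=
      ⟨hadj, hm.mono (by omega), hb.mono (by omega)⟩
    exact ⟨.cons hab q, by simp [hq]⟩

theorem SimpleGraph.Walk.notMem_support_of_isolated {H : SimpleGraph V} {u v w : V}
    (huw : u ≠ w) (hw : ∀ z, ¬H.Adj w z) (p : H.Walk u v) : w ∉ p.support := by
  induction p with
  | nil => simpa using huw.symm
  | @cons a b _ hadj p ih =>
    rw [SimpleGraph.Walk.support_cons, List.mem_cons, not_or]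
    exact ⟨huw.symm, ih fun h => hw a (h ▸ hadj.symm)⟩

/-- Go to w and back, then pad to the exact length by stepping back and forth along the first edge.
-/
theorem SimpleGraph.Walk.exists_closed_through {K : SimpleGraph V} {u w : V} (huw : u ≠ w)
    (p : K.Walk u w) (r : ℕ) (hr : p.length ≤ r) :
    ∃ q : K.Walk u u, q.length = 2 * r ∧ w ∈ q.support := by
  induction r, hr using Nat.le_induction with
  | base =>
    refine ⟨p.append p.reverse, by simp [two_mul], ?_⟩
    simp [SimpleGraph.Walk.mem_support_append_iff]
  | succ r _ ih =>
    obtain ⟨q, hq, hwq⟩ := ih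
    cases p with
    | nil => exact absurd rfl huw
    | cons hadj p' =>
      exact ⟨.cons hadj (.cons hadj.symm q), by simp [hq]; ring, by simp [hwq]⟩

variable [Fintype V]

theorem adjMatrix_pow_apply_le {H K : SimpleGraph V} (h : H ≤ K) (m : ℕ) (u v : V) :
    ((H.adjMatrix ℝ) ^ m) u v ≤ ((K.adjMatrix ℝ) ^ m) u v := by
  rw [SimpleGraph.adjMatrix_pow_apply_eq_card_walk, SimpleGraph.adjMatrix_pow_apply_eq_card_walk]
  have : Fintype.card {p : H.Walk u v | p.length = m} ≤
      Fintype.card {p : K.Walk u v | p.length = m} :=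
    Fintype.card_le_of_injective (fun p => ⟨p.1.mapLe h, (p.1.length_map _).trans p.2⟩) fun p q hpq =>
      Subtype.ext (SimpleGraph.Walk.map_injective_of_injective (f := .ofLE h)
        Function.injective_id u _ (congrArg Subtype.val hpq))
  exact_mod_cast this

/-- A vertex isolated in a subgraph but close to `u` adds a closed walk at `u`. -/
theorem adjMatrix_pow_apply_self_add_one_le {H K : SimpleGraph V} (h : H ≤ K) {u w : V}
    (huw : u ≠ w) (hw : ∀ z, ¬H.Adj w z) (r : ℕ) (hp : K.WithinDist r u w) :
    ((H.adjMatrix ℝ) ^ (2 * r)) u u + 1 ≤ ((K.adjMatrix ℝ) ^ (2 * r)) u u := by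
  obtain ⟨p, hp⟩ := hp
  obtain ⟨q, hq, hwq⟩ := p.exists_closed_through huw r hp
  rw [SimpleGraph.adjMatrix_pow_apply_eq_card_walk, SimpleGraph.adjMatrix_pow_apply_eq_card_walk]
  have : Fintype.card {p : H.Walk u u | p.length = 2 * r} + 1 ≤
      Fintype.card {p : K.Walk u u | p.length = 2 * r} := by
    refine Fintype.card_lt_of_injective_of_notMem (b := ⟨q, hq⟩)
      (fun p => ⟨p.1.mapLe h, (p.1.length_map _).trans p.2⟩) (fun p p' hpp =>
      Subtype.ext (SimpleGraph.Walk.map_injective_of_injective (f := .ofLE h)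
        Function.injective_id u _ (congrArg Subtype.val hpp))) ?_
    rintro ⟨p', hp'⟩
    have h1 : p'.1.mapLe h = q := congrArg Subtype.val hp'
    have h2 := p'.1.notMem_support_of_isolated huw hw
    rw [← h1] at hwq
    exact h2 (by simpa using hwq)
  exact_mod_cast this

theorem adjMatrix_pow_transpose (G : SimpleGraph V) (m : ℕ) :
    ((G.adjMatrix ℝ) ^ m)ᵀ = (G.adjMatrix ℝ) ^ m := by
  rw [transpose_pow, SimpleGraph.transpose_adjMatrix]

theorem adjMatrix_pow_nonneg (G : SimpleGraph V) (m : ℕ) (u v : V) :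
    0 ≤ ((G.adjMatrix ℝ) ^ m) u v := by
  rw [SimpleGraph.adjMatrix_pow_apply_eq_card_walk]; positivity

theorem dotProduct_pow_mulVec (G : SimpleGraph V) (m : ℕ) (y : V → ℝ) :
    ((G.adjMatrix ℝ) ^ m *ᵥ y) ⬝ᵥ ((G.adjMatrix ℝ) ^ m *ᵥ y) =
      y ⬝ᵥ ((G.adjMatrix ℝ) ^ (2 * m) *ᵥ y) := by
  rw [two_mul, pow_add, ← mulVec_mulVec, dotProduct_mulVec y, ← mulVec_transpose,
    adjMatrix_pow_transpose]

theorem dotProduct_pow_mulVec_self_le (G : SimpleGraph V) (c : ℝ) (hc : 0 < c)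
    (hpsd : ∀ x, 0 ≤ quadForm G c x) (m : ℕ) (y : V → ℝ) :
    ((G.adjMatrix ℝ) ^ m *ᵥ y) ⬝ᵥ ((G.adjMatrix ℝ) ^ m *ᵥ y) ≤ c ^ (2 * m) * (y ⬝ᵥ y) := by
  induction m with
  | zero => simp
  | succ m ih =>
    rw [pow_succ', ← mulVec_mulVec]
    refine (dotProduct_mulVec_self_le G c hc hpsd _).trans ?_
    calc _ ≤ c ^ 2 * (c ^ (2 * m) * (y ⬝ᵥ y)) := mul_le_mul_of_nonneg_left ih (by positivity)
      _ = _ := by ring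

/-- Deleting vertices near every point of the support of a nonnegative vector makes powers of the
adjacency matrix expand it less. -/
theorem dotProduct_pow_mulVec_le_sub_one {H K : SimpleGraph V} (h : H ≤ K) (c : ℝ) (hc : 0 < c)
    (hpsd : ∀ x, 0 ≤ quadForm K c x) (r : ℕ) (y : V → ℝ) (hy : 0 ≤ y)
    (hnet : ∀ u, y u ≠ 0 → ∃ w, u ≠ w ∧ (∀ z, ¬H.Adj w z) ∧ K.WithinDist r u w) :
    ((H.adjMatrix ℝ) ^ r *ᵥ y) ⬝ᵥ ((H.adjMatrix ℝ) ^ r *ᵥ y) ≤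
      (c ^ (2 * r) - 1) * (y ⬝ᵥ y) := by
  have h1 := dotProduct_pow_mulVec_self_le K c hc hpsd r y
  rw [dotProduct_pow_mulVec] at h1 ⊢
  -- Each diagonal entry on the support of y gains at least one closed walk, through a deleted
  -- vertex; the other entries do not decrease.
  have h2 : y ⬝ᵥ ((H.adjMatrix ℝ) ^ (2 * r) *ᵥ y) + y ⬝ᵥ y ≤
      y ⬝ᵥ ((K.adjMatrix ℝ) ^ (2 * r) *ᵥ y) := by
    simp only [dotProduct, mulVec, ← Finset.sum_add_distrib]
    refine Finset.sum_le_sum fun u _ => ?_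
    rw [← mul_add]
    refine mul_le_mul_of_nonneg_left ?_ (hy u)
    by_cases hu : y u = 0
    · rw [hu, add_zero]
      exact Finset.sum_le_sum fun v _ =>
        mul_le_mul_of_nonneg_right (adjMatrix_pow_apply_le h _ u v) (hy v)
    · obtain ⟨w, huw, hw, hd⟩ := hnet u hu
      have h3 := adjMatrix_pow_apply_self_add_one_le h huw hw r hd
      rw [← Finset.add_sum_erase _ _ (Finset.mem_univ u), ← Finset.add_sum_erase (a := u)
        _ (fun v => ((K.adjMatrix ℝ) ^ (2 * r)) u v * y v) (Finset.mem_univ u)]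
      have h4 : ∑ v ∈ Finset.univ.erase u, ((H.adjMatrix ℝ) ^ (2 * r)) u v * y v ≤
          ∑ v ∈ Finset.univ.erase u, ((K.adjMatrix ℝ) ^ (2 * r)) u v * y v :=
        Finset.sum_le_sum fun v _ =>
          mul_le_mul_of_nonneg_right (adjMatrix_pow_apply_le h _ u v) (hy v)
      nlinarith [mul_le_mul_of_nonneg_right h3 (hy u)]
  linarith

/-- Powers of the adjacency matrix applied to the indicator of `v` only see the ball around `v`. -/
theorem pow_mulVec_single_eq_of_le (G : SimpleGraph V) (s : Set V) (v : V) (hv : v ∈ s)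
    (R j : ℕ) (hj : j ≤ R) :
    (((G.edgesWithin (s ∩ {z | G.WithinDist R v z})).adjMatrix ℝ) ^ j *ᵥ Pi.single v 1 =
      ((G.edgesWithin s).adjMatrix ℝ) ^ j *ᵥ Pi.single v 1) ∧
    ∀ u, (((G.edgesWithin s).adjMatrix ℝ) ^ j *ᵥ Pi.single v 1) u ≠ 0 →
      u ∈ s ∧ G.WithinDist j v u := by
  induction j with
  | zero =>
    refine ⟨by simp, fun u hu => ?_⟩
    have : u = v := by
      by_contra hne
      exact hu (by simp [hne])
    subst this
    exact ⟨hv, SimpleGraph.WithinDist.refl G _ _⟩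
  | succ j ih =>
    obtain ⟨ih1, ih2⟩ := ih (by omega)
    rw [pow_succ', pow_succ', ← mulVec_mulVec, ← mulVec_mulVec, ih1]
    set y := ((G.edgesWithin s).adjMatrix ℝ) ^ j *ᵥ Pi.single v 1
    constructor
    · funext u
      refine Finset.sum_congr rfl fun w _ => ?_
      by_cases hw : y w = 0
      · simp [hw]
      · have hws := ih2 w hw
        congr 1
        simp only [SimpleGraph.adjMatrix_apply, SimpleGraph.edgesWithin_adj]
        congr 1
        refine propext ⟨fun h => ⟨h.1, h.2.1.1, h.2.2.1⟩, fun h => ⟨h.1, ⟨h.2.1, ?_⟩, hws.1, ?_⟩⟩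
        · exact (hws.2.trans h.1.symm.withinDist).mono hj
        · exact hws.2.mono (by omega)
    · intro u hu
      obtain ⟨w, -, hw⟩ := Finset.exists_ne_zero_of_sum_ne_zero hu
      have hyw : y w ≠ 0 := right_ne_zero_of_mul hw
      have hA := left_ne_zero_of_mul hw
      simp only [SimpleGraph.adjMatrix_apply, SimpleGraph.edgesWithin_adj] at hA
      have hadj := (ite_ne_right_iff.1 hA).1
      exact ⟨hadj.2.1, (ih2 w hyw).2.trans hadj.1.symm.withinDist⟩

/-- If `c I - A` is positive semidefinite on the ball of radius `r * j` around `v` and every vertex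
of `s` is within distance `r` of a vertex outside `s`, then the number of closed walks at `v`
inside `s` decays. -/
theorem dotProduct_pow_mulVec_single_le (G : SimpleGraph V) (s : Set V) (v : V) (hv : v ∈ s)
    (c : ℝ) (hc : 1 ≤ c) (r n : ℕ)
    (hball : ∀ x : V → ℝ, (∀ u, ¬G.WithinDist (r * n) v u → x u = 0) → 0 ≤ quadForm G c x)
    (hnet : ∀ u ∈ s, ∃ w ∉ s, G.WithinDist r u w) (j : ℕ) (hj : j ≤ n) :
    (((G.edgesWithin s).adjMatrix ℝ) ^ (r * j) *ᵥ Pi.single v 1) ⬝ᵥ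
      (((G.edgesWithin s).adjMatrix ℝ) ^ (r * j) *ᵥ Pi.single v 1) ≤ (c ^ (2 * r) - 1) ^ j := by
  induction j with
  | zero =>
    rw [mul_zero, pow_zero, pow_zero, one_mulVec]
    simp
  | succ j ih =>
    have hle : r * (j + 1) ≤ r * n := Nat.mul_le_mul_left r hj
    have hle' : r * j + r ≤ r * n := by rwa [← Nat.mul_succ]
    have h1 := (pow_mulVec_single_eq_of_le G s v hv (r * n) (r * (j + 1)) hle).1
    obtain ⟨h2, h3⟩ := pow_mulVec_single_eq_of_le G s v hv (r * n) (r * j) (by omega)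
    rw [← h1, show r * (j + 1) = r + r * j by ring, pow_add, ← mulVec_mulVec, h2]
    -- Semidefiniteness is known only on the ball, so both graphs are cut down to it. Since r j + r
    -- ≤ r n, the walks to deleted vertices still stay inside.
    have h4 := dotProduct_pow_mulVec_le_sub_one
      (H := G.edgesWithin (s ∩ {z | G.WithinDist (r * n) v z}))
      (K := G.edgesWithin {z | G.WithinDist (r * n) v z})
      (fun a b h => ⟨h.1, h.2.1.2, h.2.2.2⟩) c (by linarith)
      (quadForm_edgesWithin_nonneg G c (by linarith) _ hball) r
      (((G.edgesWithin s).adjMatrix ℝ) ^ (r * j) *ᵥ Pi.single v 1)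
      (fun u => Finset.sum_nonneg fun w _ => mul_nonneg (adjMatrix_pow_nonneg _ _ _ _)
        (by rw [Pi.single_apply]; split_ifs <;> norm_num))
      (fun u hu => by
        obtain ⟨hus, hud⟩ := h3 u hu
        obtain ⟨w, hws, p, hp⟩ := hnet u hus
        obtain ⟨q, hq⟩ := p.exists_edgesWithin_of_withinDist (R := r * n) _ hud (by omega)
        exact ⟨w, fun h => hws (h ▸ hus), fun z hz => hws hz.2.1.1, q, hq ▸ hp⟩)
    refine h4.trans ?_
    rw [pow_succ']
    exact mul_le_mul_of_nonneg_left (ih (by omega)) (sub_nonneg.2 (one_le_pow₀ hc))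

end LocalDecay

/-! ### Ball sizes and sparse nets -/

section Nets

open scoped Classical

variable {V : Type*} [Fintype V]

theorem SimpleGraph.card_withinDist_le (G : SimpleGraph V) (Δ : ℕ)
    (hΔ : ∀ v, (Finset.univ.filter (G.Adj v)).card ≤ Δ) (R : ℕ) (v : V) :
    (Finset.univ.filter (G.WithinDist R v)).card ≤ (Δ + 1) ^ R := by
  induction R generalizing v with
  | zero =>
    rw [pow_zero, Finset.card_le_one]
    have h : ∀ a, G.WithinDist 0 v a → v = a := fun a ⟨p, hp⟩ =>
      SimpleGraph.Walk.eq_of_length_eq_zero (Nat.le_zero.1 hp)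
    intro a ha b hb
    rw [← h a (Finset.mem_filter.1 ha).2, ← h b (Finset.mem_filter.1 hb).2]
  | succ R ih =>
    have hsub : Finset.univ.filter (G.WithinDist (R + 1) v) ⊆
        (insert v (Finset.univ.filter (G.Adj v))).biUnion
          fun w => Finset.univ.filter (G.WithinDist R w) := by
      intro u hu
      obtain ⟨p, hp⟩ := (Finset.mem_filter.1 hu).2
      rw [Finset.mem_biUnion]
      cases p with
      | nil => exact ⟨v, Finset.mem_insert_self _ _, by
          simpa using SimpleGraph.WithinDist.refl G R v⟩
      | @cons _ b _ hadj q =>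
        refine ⟨b, Finset.mem_insert_of_mem (by simpa using hadj), ?_⟩
        simp only [Finset.mem_filter, Finset.mem_univ, true_and]
        exact ⟨q, by simpa using hp⟩
    calc _ ≤ _ := Finset.card_le_card hsub
      _ ≤ (insert v (Finset.univ.filter (G.Adj v))).card * (Δ + 1) ^ R :=
        Finset.card_biUnion_le_card_mul _ _ _ fun w _ => ih w
      _ ≤ (Δ + 1) * (Δ + 1) ^ R := Nat.mul_le_mul_right _
        ((Finset.card_insert_le _ _).trans (Nat.succ_le_succ (hΔ v)))
      _ = _ := (pow_succ' _ _).symm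

theorem SimpleGraph.le_card_withinDist (G : SimpleGraph V) (t : ℕ) (u w : V)
    (h : G.Reachable u w) (hn : ¬G.WithinDist t u w) :
    t + 1 ≤ (Finset.univ.filter (G.WithinDist t u)).card := by
  obtain ⟨p, hp⟩ := h.exists_isPath
  have hlen : t < p.length := by
    by_contra hle
    exact hn ⟨p, not_lt.1 hle⟩
  have himg : (Finset.range (t + 1)).image p.getVert ⊆
      Finset.univ.filter (G.WithinDist t u) := by
    intro z hz
    obtain ⟨i, hi, rfl⟩ := Finset.mem_image.1 hz
    simp only [Finset.mem_filter, Finset.mem_univ, true_and]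
    have hi' := Finset.mem_range.1 hi
    exact ⟨p.take i, by rw [SimpleGraph.Walk.take_length]; omega⟩
  have hcard : ((Finset.range (t + 1)).image p.getVert).card = t + 1 := by
    rw [Finset.card_image_of_injOn, Finset.card_range]
    intro i hi j hj hij
    have hi' := Finset.mem_range.1 (Finset.mem_coe.1 hi)
    have hj' := Finset.mem_range.1 (Finset.mem_coe.1 hj)
    exact hp.getVert_injOn (by rw [Set.mem_ofPred_eq]; omega) (by rw [Set.mem_ofPred_eq]; omega) hij
  exact hcard ▸ Finset.card_le_card himg

/-- A set of mutually reachable vertices has a net of radius `2 t` with about `n / (t + 1)`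
elements. -/
theorem SimpleGraph.exists_net (G : SimpleGraph V) (s : Set V)
    (hs : ∀ u ∈ s, ∀ v ∈ s, G.Reachable u v) (t : ℕ) :
    ∃ N : Finset V, (∀ u ∈ s, ∃ w ∈ N, G.WithinDist (2 * t) u w) ∧
      N.card * (t + 1) ≤ Fintype.card V + (t + 1) := by
  -- A largest set of points pairwise more than 2t apart is a net, and the balls of radius t around
  -- its points are disjoint.
  let P : Finset (Finset V) := Finset.univ.filter fun N =>
    (∀ u ∈ N, u ∈ s) ∧ ∀ u ∈ N, ∀ v ∈ N, u ≠ v → ¬G.WithinDist (2 * t) u v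
  obtain ⟨N, hN, hmax⟩ := P.exists_max_image Finset.card ⟨∅, by simp [P]⟩
  obtain ⟨hNs, hsep⟩ := (Finset.mem_filter.1 hN).2
  refine ⟨N, ?_, ?_⟩
  · intro u hu
    by_contra! hcon
    have huN : u ∉ N := fun h => hcon u h (SimpleGraph.WithinDist.refl G _ u)
    have hmem : insert u N ∈ P := by
      simp only [P, Finset.mem_filter, Finset.mem_univ, true_and, Finset.mem_insert]
      refine ⟨?_, ?_⟩
      · rintro v (rfl | hv)
        · exact hu
        · exact hNs v hv
      · rintro v (rfl | hv) w (rfl | hw) hne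
        · exact absurd rfl hne
        · exact hcon w hw
        · exact fun h => hcon v hv h.symm
        · exact hsep v hv w hw hne
    have := hmax _ hmem
    rw [Finset.card_insert_of_notMem huN] at this
    omega
  -- With at least two points, a path from one towards another puts t + 1 vertices in each ball. A
  -- lone point has no such guarantee, hence the extra t + 1.
  · rcases Nat.lt_or_ge 1 N.card with h1 | h1
    · have hball : ∀ u ∈ N, t + 1 ≤ (Finset.univ.filter (G.WithinDist t u)).card := by
        intro u hu
        obtain ⟨w, hw, hne⟩ := Finset.exists_mem_ne h1 u
        exact G.le_card_withinDist t u w (hs u (hNs u hu) w (hNs w hw)) fun h =>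
          hsep u hu w hw hne.symm (h.mono (by omega))
      have hdisj : (N : Set V).PairwiseDisjoint fun u => Finset.univ.filter (G.WithinDist t u) := by
        intro u hu v hv hne
        rw [Function.onFun, Finset.disjoint_left]
        intro z hz hz'
        simp only [Finset.mem_filter, Finset.mem_univ, true_and] at hz hz'
        exact hsep u hu v hv hne ((hz.trans hz'.symm).mono (by omega))
      calc N.card * (t + 1) ≤ ∑ u ∈ N, (Finset.univ.filter (G.WithinDist t u)).card := by
            simpa using Finset.card_nsmul_le_sum N _ (t + 1) hball
        _ = (N.biUnion fun u => Finset.univ.filter (G.WithinDist t u)).card :=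
            (Finset.card_biUnion hdisj).symm
        _ ≤ Fintype.card V := Finset.card_le_univ _
        _ ≤ _ := Nat.le_add_right _ _
    · calc N.card * (t + 1) ≤ 1 * (t + 1) := Nat.mul_le_mul_right _ h1
        _ ≤ _ := by omega

end Nets

/-! ### Multiplicity of c when A has an eigenvalue above c -/

section Indefinite

open scoped Classical
open Matrix

variable {V : Type*} [Fintype V]

/-- The form at |u| is the sum of its values on the components, so one of them is negative. -/
theorem exists_component_quadForm_neg (G : SimpleGraph V) (c : ℝ)
    (hneg : ∃ u : V → ℝ, quadForm G c u < 0) :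
    ∃ (C : G.ConnectedComponent) (u : V → ℝ), 0 ≤ u ∧
      (∀ v, G.connectedComponentMk v ≠ C → u v = 0) ∧ quadForm G c u < 0 := by
  obtain ⟨u, hu⟩ := hneg
  have hu' := (quadForm_abs_le G c u).trans_lt hu
  have hclosed : ∀ C : G.ConnectedComponent, ∀ a b, G.Adj a b →
      a ∈ {v | G.connectedComponentMk v = C} → b ∈ {v | G.connectedComponentMk v = C} := by
    intro C a b hab ha
    have : G.connectedComponentMk b = G.connectedComponentMk a :=
      SimpleGraph.ConnectedComponent.sound hab.symm.reachable
    exact this.trans ha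
  have hsum : quadForm G c |u| =
      ∑ C : G.ConnectedComponent, quadForm G c ({v | G.connectedComponentMk v = C}.indicator |u|) := by
    simp_rw [quadForm_indicator G c _ (hclosed _)]
    rw [Finset.sum_comm, quadForm_eq_sum]
    refine Finset.sum_congr rfl fun v _ => ?_
    simp [Set.indicator_apply]
  rw [hsum] at hu'
  obtain ⟨C, -, hC⟩ := Finset.exists_lt_of_sum_lt (g := fun _ => (0 : ℝ)) (by simpa using hu')
  refine ⟨C, _, fun v => ?_, fun v hv => ?_, hC⟩
  · exact Set.indicator_nonneg (fun v _ => abs_nonneg (u v)) v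
  · exact Set.indicator_of_notMem (by simpa using hv) _

/-- If `c I - A` is indefinite on one component, every eigenvector of eigenvalue `c` lives there. -/
theorem eigenvector_eq_zero_off_component (G : SimpleGraph V) (c : ℝ)
    (hM : ∀ x, 0 ≤ quadForm G c x + (∑ v, x v) ^ 2 / 2) (C : G.ConnectedComponent) (u : V → ℝ)
    (huC : ∀ v, G.connectedComponentMk v ≠ C → u v = 0) (hun : quadForm G c u < 0)
    (x : V → ℝ) (hx : G.adjMatrix ℝ *ᵥ x = c • x) (v : V) (hv : G.connectedComponentMk v ≠ C) :
    x v = 0 := by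
  by_contra hxv
  have hclosed : ∀ a b, G.Adj a b →
      a ∈ {v | G.connectedComponentMk v ≠ C} → b ∈ {v | G.connectedComponentMk v ≠ C} := by
    intro a b hab ha hb
    have : G.connectedComponentMk a = G.connectedComponentMk b :=
      SimpleGraph.ConnectedComponent.sound hab.reachable
    exact ha (this.trans hb)
  set y := {v | G.connectedComponentMk v ≠ C}.indicator x with hy
  have hQ : quadForm G c y = 0 := by
    rw [hy, quadForm_indicator G c _ hclosed, hx]
    simp
  refine false_of_two_nonpos G c hM u |y| (abs_nonneg y) ?_ hun
    ((quadForm_abs_le G c y).trans hQ.le) ?_ ?_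
  · intro h
    have := congrFun h v
    simp [hy, hv, hxv] at this
  · intro w
    by_cases hw : G.connectedComponentMk w = C
    · simp [hy, hw]
    · simp [huC w hw]
  · intro w w' hww
    by_cases hw : G.connectedComponentMk w = C
    · have : G.connectedComponentMk w' = C :=
        (SimpleGraph.ConnectedComponent.sound hww.symm.reachable).trans hw
      simp [hy, this]
    · simp [huC w hw]

/-- The vertices around which `c I - A` is not positive semidefinite lie in a bounded ball. -/
theorem card_quadForm_neg_le (G : SimpleGraph V) (Δ : ℕ)
    (hΔ : ∀ v, (Finset.univ.filter (G.Adj v)).card ≤ Δ) (c : ℝ)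
    (hM : ∀ x, 0 ≤ quadForm G c x + (∑ v, x v) ^ 2 / 2) (R : ℕ) :
    (Finset.univ.filter fun v => ∃ x : V → ℝ, (∀ u, ¬G.WithinDist R v u → x u = 0) ∧
      quadForm G c x < 0).card ≤ (Δ + 1) ^ (2 * R + 1) := by
  set U := Finset.univ.filter fun v => ∃ x : V → ℝ, (∀ u, ¬G.WithinDist R v u → x u = 0) ∧
      quadForm G c x < 0 with hU
  rcases U.eq_empty_or_nonempty with h | ⟨v₀, hv₀⟩
  · simp [h]
  refine (Finset.card_le_card fun v hv => ?_).trans (G.card_withinDist_le Δ hΔ (2 * R + 1) v₀)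
  simp only [Finset.mem_filter, Finset.mem_univ, true_and]
  -- Two centres more than 2R + 1 apart have disjoint, non-adjacent balls, which
  -- `false_of_two_nonpos` excludes.
  by_contra hfar
  obtain ⟨x, hx, hxn⟩ := (Finset.mem_filter.1 hv₀).2
  obtain ⟨y, hy, hyn⟩ := (Finset.mem_filter.1 hv).2
  refine false_of_two_nonpos G c hM x |y| (abs_nonneg y) ?_ hxn
    ((quadForm_abs_le G c y).trans hyn.le) ?_ ?_
  · intro h0
    have := (quadForm_abs_le G c y).trans_lt hyn
    rw [h0] at this
    simp [quadForm] at this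
  · intro w
    by_cases hw : G.WithinDist R v₀ w
    · have : ¬G.WithinDist R v w := fun h => hfar ((hw.trans h.symm).mono (by omega))
      simp [hy w this]
    · simp [hx w hw]
  · intro w w' hww
    by_cases hw : G.WithinDist R v₀ w
    · have : ¬G.WithinDist R v w' := fun h =>
        hfar (((hw.trans hww.withinDist).trans h.symm).mono (by omega))
      simp [hy w' this]
    · simp [hx w hw]

/-- Such eigenvectors remain eigenvectors of the graph B inside s. The multiplicity is bounded by
the Frobenius norm of B^(rn), whose rows satisfy the local decay estimate. -/
theorem finrank_eigenspace_supported_le (G : SimpleGraph V) (s : Set V) (c : ℝ) (hc : 1 ≤ c)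
    (r n : ℕ) (hr : 0 < r * n)
    (hball : ∀ v ∈ s, ∀ x : V → ℝ, (∀ u, ¬G.WithinDist (r * n) v u → x u = 0) →
      0 ≤ quadForm G c x)
    (hnet : ∀ u ∈ s, ∃ w ∉ s, G.WithinDist r u w) (W : Submodule ℝ (V → ℝ))
    (hW : ∀ x ∈ W, G.adjMatrix ℝ *ᵥ x = c • x) (hWs : ∀ x ∈ W, ∀ v ∉ s, x v = 0) :
    (Module.finrank ℝ W : ℝ) * c ^ (2 * (r * n)) ≤
      Fintype.card V * (c ^ (2 * r) - 1) ^ n := by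
  set B := (G.edgesWithin s).adjMatrix ℝ with hB
  have heig : ∀ x ∈ W, B *ᵥ x = c • x := by
    intro x hx
    funext v
    by_cases hv : v ∈ s
    · rw [← hW x hx]
      refine Finset.sum_congr rfl fun u _ => ?_
      by_cases hu : u ∈ s
      · simp [hB, SimpleGraph.adjMatrix_apply, hv, hu]
      · simp [hWs x hx u hu]
    · rw [Pi.smul_apply, hWs x hx v hv, smul_zero]
      exact Finset.sum_eq_zero fun u _ => by simp [hB, SimpleGraph.adjMatrix_apply, hv]
  have hpow : ∀ (m : ℕ), ∀ x ∈ W, B ^ m *ᵥ x = c ^ m • x := by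
    intro m x hx
    induction m with
    | zero => simp
    | succ m ih => rw [pow_succ, ← mulVec_mulVec, heig x hx, mulVec_smul, ih, smul_smul, pow_succ']
  have h1 := finrank_mul_sq_le_of_eigenspace (B ^ (r * n)) (c ^ (r * n)) W (hpow _)
  rw [← pow_mul, mul_comm (r * n) 2] at h1
  refine h1.trans ?_
  rw [← Finset.card_univ, ← nsmul_eq_mul]
  refine Finset.sum_le_card_nsmul _ _ _ fun v _ => ?_
  have hrow : (B ^ (r * n)).row v = B ^ (r * n) *ᵥ Pi.single v 1 := by
    rw [mulVec_single_one]
    exact congrFun (adjMatrix_pow_transpose (G.edgesWithin s) (r * n)).symm v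
  rw [hrow]
  by_cases hv : v ∈ s
  · exact dotProduct_pow_mulVec_single_le G s v hv c hc r n (hball v hv) hnet n le_rfl
  -- Outside s the vertex is isolated; its row vanishes because the exponent r n is positive.
  · have h0 : B *ᵥ Pi.single v 1 = 0 := by
      rw [mulVec_single_one]
      funext u
      simp [hB, SimpleGraph.adjMatrix_apply, hv]
    obtain ⟨m, hm⟩ := Nat.exists_eq_add_of_lt hr
    rw [hm, zero_add, pow_succ, ← mulVec_mulVec, h0]
    simpa using pow_nonneg (sub_nonneg.2 (one_le_pow₀ hc)) n

/-- The multiplicity bound when `c I - A` has a negative eigenvalue. -/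
theorem finrank_eigenspace_le_of_quadForm_neg (G : SimpleGraph V) (Δ : ℕ)
    (hΔ : ∀ v, (Finset.univ.filter (G.Adj v)).card ≤ Δ) (c : ℝ) (hc : 1 ≤ c)
    (hM : ∀ x, 0 ≤ quadForm G c x + (∑ v, x v) ^ 2 / 2)
    (hneg : ∃ u : V → ℝ, quadForm G c u < 0) (t n : ℕ) (ht : 0 < t) (hn : 0 < n)
    (W : Submodule ℝ (V → ℝ)) (hW : ∀ x ∈ W, G.adjMatrix ℝ *ᵥ x = c • x) :
    (Module.finrank ℝ W : ℝ) ≤ Fintype.card V * (1 - 1 / c ^ (4 * t)) ^ n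
      + (Δ + 1) ^ (4 * t * n + 1) + (Fintype.card V / (t + 1) + 1) := by
  obtain ⟨C, u, -, huC, hun⟩ := exists_component_quadForm_neg G c hneg
  obtain ⟨N, hN, hNcard⟩ := G.exists_net {v | G.connectedComponentMk v = C}
    (fun a ha b hb => SimpleGraph.ConnectedComponent.exact (ha.trans hb.symm)) t
  set U := Finset.univ.filter fun v => ∃ x : V → ℝ,
    (∀ u, ¬G.WithinDist (2 * t * n) v u → x u = 0) ∧ quadForm G c x < 0 with hU
  have hUcard : U.card ≤ (Δ + 1) ^ (4 * t * n + 1) := by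
    have := card_quadForm_neg_le G Δ hΔ c hM (2 * t * n)
    rwa [show 2 * (2 * t * n) + 1 = 4 * t * n + 1 by ring] at this
  -- Requiring vectors to vanish on the bad centres `U` and the net `N` costs at most their number
  -- of dimensions; what is left is supported where the decay applies.
  obtain ⟨W', hW'W, hW'0, hWW'⟩ := W.finrank_le_finrank_inf_vanishing_add (U ∪ N)
  have hmain := finrank_eigenspace_supported_le G
    {v | G.connectedComponentMk v = C ∧ v ∉ U ∧ v ∉ N} c hc (2 * t) n (by positivity)
    (fun v hv x hx => by
      by_contra hlt
      exact hv.2.1 (Finset.mem_filter.2 ⟨Finset.mem_univ v, x, hx, not_le.1 hlt⟩))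
    (fun v hv => by
      obtain ⟨w, hw, hd⟩ := hN v hv.1
      exact ⟨w, fun h => h.2.2 hw, hd⟩) W' (fun x hx => hW x (hW'W hx))
    (fun x hx v hv => by
      by_cases hvC : G.connectedComponentMk v = C
      · refine hW'0 x hx v ?_
        by_contra h
        rw [Finset.mem_union, not_or] at h
        exact hv ⟨hvC, h⟩
      · exact eigenvector_eq_zero_off_component G c hM C u huC hun x (hW x (hW'W hx)) v hvC)
  have hcpos : 0 < c := by linarith
  have h1 : (Module.finrank ℝ W' : ℝ) ≤ Fintype.card V * (1 - 1 / c ^ (4 * t)) ^ n := by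
    have hp : 0 < c ^ (2 * (2 * t * n)) := by positivity
    refine le_of_mul_le_mul_right (hmain.trans (le_of_eq ?_)) hp
    rw [show 2 * (2 * t * n) = 4 * t * n by ring, show 2 * (2 * t) = 4 * t by ring,
      pow_mul c (4 * t) n, mul_assoc, ← mul_pow]
    congr 2
    field_simp
  have h2 : (Module.finrank ℝ W : ℝ) ≤ Module.finrank ℝ W' + (U.card + N.card) := by
    have := hWW'.trans (Nat.add_le_add_left (Finset.card_union_le U N) _)
    exact_mod_cast this
  have h3 : (U.card : ℝ) ≤ (Δ + 1) ^ (4 * t * n + 1) := by exact_mod_cast hUcard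
  have h4 : (N.card : ℝ) ≤ Fintype.card V / (t + 1) + 1 := by
    have h5 : (N.card : ℝ) * (t + 1) ≤ Fintype.card V + (t + 1) := by exact_mod_cast hNcard
    have h6 : (0 : ℝ) < t + 1 := by positivity
    rw [div_add_one h6.ne', le_div_iff₀ h6]
    exact h5
  linarith

end Indefinite

/-! ### Corank of the Gram matrix -/

section Corank

open scoped Classical
open Matrix

/-- The corank of `(k - 1) I - A + J / 2`, when this matrix is positive semidefinite and the graph
has bounded degree. -/
theorem exists_corank_bound (k : ℕ) (hk : 2 ≤ k) (Δ : ℕ) :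
    ∃ B : ℝ, 0 ≤ B ∧ ∀ (V : Type) [Fintype V] (G : SimpleGraph V),
      (∀ v, (Finset.univ.filter (G.Adj v)).card ≤ Δ) →
      (∀ x : V → ℝ, 0 ≤ quadForm G ((k : ℝ) - 1) x + (∑ v, x v) ^ 2 / 2) →
      ∀ K : Submodule ℝ (V → ℝ),
        (∀ x ∈ K, ∀ v, ((k : ℝ) - 1) * x v - (G.adjMatrix ℝ *ᵥ x) v + (∑ u, x u) / 2 = 0) →
        Module.finrank ℝ K = 0 ∨ k * (Module.finrank ℝ K + 1) ≤ Fintype.card V ∨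
          (Module.finrank ℝ K : ℝ) ≤ Fintype.card V / (2 * k) + B := by
  have hk' : (2 : ℝ) ≤ k := by exact_mod_cast hk
  have hc : (1 : ℝ) ≤ (k : ℝ) - 1 := by linarith
  set c : ℝ := (k : ℝ) - 1
  -- The net then contributes at most n/(4k), and the exponent chosen below makes the walk term at
  -- most n/(4k), for n/(2k) in total.
  set t : ℕ := 4 * k
  have hct : 0 < 1 / c ^ (4 * t) := by positivity
  have hct' : 1 / c ^ (4 * t) ≤ 1 := by
    rw [div_le_one (by positivity)]
    exact one_le_pow₀ hc
  obtain ⟨n₀, hn₀⟩ := exists_pow_lt_of_lt_one (show (0 : ℝ) < 1 / (4 * k) by positivity)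
    (show 1 - 1 / c ^ (4 * t) < 1 by linarith)
  have hn : (1 - 1 / c ^ (4 * t)) ^ (n₀ + 1) ≤ 1 / (4 * k) :=
    (pow_le_pow_of_le_one (by linarith) (by linarith) (Nat.le_succ n₀)).trans hn₀.le
  -- The 2 accounts for the additive 1 in the net bound and for the passage to the sum-zero
  -- hyperplane.
  refine ⟨((Δ : ℝ) + 1) ^ (4 * t * (n₀ + 1) + 1) + 2, by positivity, ?_⟩
  intro V _ G hΔ hM K hK
  have hdot : ∀ x ∈ K, quadForm G c x + (∑ v, x v) ^ 2 / 2 = 0 := by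
    intro x hx
    rw [quadForm_eq_sum, sq, mul_div_assoc, Finset.sum_mul, ← Finset.sum_add_distrib]
    refine Finset.sum_eq_zero fun v _ => ?_
    rw [← mul_add, hK x hx v, mul_zero]
  by_cases hpsd : ∀ x, 0 ≤ quadForm G c x
  · refine (finrank_sum_zero_eigenspace_le G k hpsd K fun x hx => ?_).imp_right Or.inl
    have h1 := hdot x hx
    have h2 := hpsd x
    exact ⟨mulVec_eq_of_quadForm_eq_zero G c hpsd x (by nlinarith [sq_nonneg (∑ v, x v)]),
      pow_eq_zero_iff two_ne_zero |>.1 (by nlinarith [sq_nonneg (∑ v, x v)])⟩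
  · right; right
    push Not at hpsd
    let f : (V → ℝ) →ₗ[ℝ] ℝ := ∑ v, LinearMap.proj v
    have hf : ∀ x, f x = ∑ v, x v := fun x => by simp [f]
    have h1 := K.finrank_le_finrank_inf_ker_add f
    have h2 := finrank_eigenspace_le_of_quadForm_neg G Δ hΔ c hc hM hpsd t (n₀ + 1)
      (by positivity) (Nat.succ_pos _) (K ⊓ LinearMap.ker f) (fun x hx => by
        have hs : ∑ v, x v = 0 := by rw [← hf]; exact hx.2
        funext v
        have h3 := hK x hx.1 v
        rw [hs] at h3
        rw [Pi.smul_apply, smul_eq_mul]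
        linarith)
    rw [Module.finrank_self] at h1
    have h1' : (Module.finrank ℝ K : ℝ) ≤
        Module.finrank ℝ (K ⊓ LinearMap.ker f : Submodule ℝ (V → ℝ)) + 1 := by exact_mod_cast h1
    have h4 : (Fintype.card V : ℝ) * (1 - 1 / c ^ (4 * t)) ^ (n₀ + 1) ≤
        Fintype.card V * (1 / (4 * k)) := mul_le_mul_of_nonneg_left hn (Nat.cast_nonneg _)
    have h5 : (Fintype.card V : ℝ) / ((t : ℕ) + 1) ≤ Fintype.card V * (1 / (4 * k)) := by
      rw [mul_one_div]
      refine div_le_div_of_nonneg_left (Nat.cast_nonneg _) (by positivity) ?_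
      simp [t]
    have h6 : (Fintype.card V : ℝ) / (2 * k) =
        Fintype.card V * (1 / (4 * k)) + Fintype.card V * (1 / (4 * k)) := by
      field_simp
      ring
    linarith

end Corank

/-! ### Ramsey's theorem -/

section Ramsey

open scoped Classical

/-- Removing one vertex leaves at least 2^n neighbours or at least 2^n non-neighbours, and the
induction lowers a or b accordingly. -/
theorem exists_clique_or_independent {V : Type*} (G : SimpleGraph V) (a b : ℕ) (s : Finset V)
    (hs : 2 ^ (a + b) ≤ s.card) :
    (∃ t ⊆ s, t.card = a ∧ ∀ u ∈ t, ∀ v ∈ t, u ≠ v → G.Adj u v) ∨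
      ∃ t ⊆ s, t.card = b ∧ ∀ u ∈ t, ∀ v ∈ t, u ≠ v → ¬G.Adj u v := by
  induction h : a + b generalizing a b s with
  | zero =>
    exact Or.inl ⟨∅, by simp, by simp; omega, by simp⟩
  | succ n ih =>
    rcases Nat.eq_zero_or_pos a with rfl | ha
    · exact Or.inl ⟨∅, by simp⟩
    rcases Nat.eq_zero_or_pos b with rfl | hb
    · exact Or.inr ⟨∅, by simp⟩
    rw [h] at hs
    have hpos : 0 < s.card := lt_of_lt_of_le (by positivity) hs
    obtain ⟨v, hv⟩ := Finset.card_pos.1 hpos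
    have hsplit := Finset.card_filter_add_card_filter_not (s := s.erase v) (G.Adj v)
    rw [Finset.card_erase_of_mem hv] at hsplit
    have h2 : 2 ^ (n + 1) = 2 ^ n + 2 ^ n := by ring
    have hv1 : ∀ (p : V → Prop) [DecidablePred p], v ∉ (s.erase v).filter p := by simp
    have hvs : ∀ (p : V → Prop) [DecidablePred p], (s.erase v).filter p ⊆ s := fun p _ =>
      (Finset.filter_subset _ _).trans (Finset.erase_subset _ _)
    rcases Nat.lt_or_ge ((s.erase v).filter (G.Adj v)).card (2 ^ n) with h3 | h3
    · rcases ih a (b - 1) ((s.erase v).filter fun u => ¬G.Adj v u)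
        (by rw [show a + (b - 1) = n by omega]; omega) (by omega) with ⟨t, hts, h4⟩ | ⟨t, hts, h4, h5⟩
      · exact Or.inl ⟨t, hts.trans (hvs _), h4⟩
      · refine Or.inr ⟨insert v t, Finset.insert_subset hv (hts.trans (hvs _)), ?_, ?_⟩
        · rw [Finset.card_insert_of_notMem fun h => hv1 _ (hts h)]
          omega
        · have h6 : ∀ u ∈ t, ¬G.Adj v u := fun u hu => (Finset.mem_filter.1 (hts hu)).2
          intro x hx y hy hxy
          rcases Finset.mem_insert.1 hx with rfl | hx' <;>
            rcases Finset.mem_insert.1 hy with rfl | hy'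
          · exact absurd rfl hxy
          · exact h6 y hy'
          · exact fun h => h6 x hx' h.symm
          · exact h5 x hx' y hy' hxy
    · rcases ih (a - 1) b ((s.erase v).filter fun u => G.Adj v u)
        (by rw [show a - 1 + b = n by omega]; omega) (by omega) with ⟨t, hts, h4, h5⟩ | ⟨t, hts, h4⟩
      · refine Or.inl ⟨insert v t, Finset.insert_subset hv (hts.trans (hvs _)), ?_, ?_⟩
        · rw [Finset.card_insert_of_notMem fun h => hv1 _ (hts h)]
          omega
        · have h6 : ∀ u ∈ t, G.Adj v u := fun u hu => (Finset.mem_filter.1 (hts hu)).2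
          intro x hx y hy hxy
          rcases Finset.mem_insert.1 hx with rfl | hx' <;>
            rcases Finset.mem_insert.1 hy with rfl | hy'
          · exact absurd rfl hxy
          · exact h6 y hy'
          · exact (h6 x hx').symm
          · exact h5 x hx' y hy' hxy
      · exact Or.inr ⟨t, hts.trans (hvs _), h4⟩

end Ramsey

/-! ### Constraints on vectors with constant inner products -/

section Switching

open scoped Classical RealInnerProductSpace

variable {E : Type*} [NormedAddCommGroup E] [InnerProductSpace ℝ E] {V : Type*}

theorem norm_sq_sum_smul_of_pairwise_inner (x : V → E) (β : ℝ) (T : Finset V)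
    (h1 : ∀ v ∈ T, ⟪x v, x v⟫ = 1) (hT : ∀ u ∈ T, ∀ v ∈ T, u ≠ v → ⟪x u, x v⟫ = β) (e : V → ℝ) :
    ‖∑ v ∈ T, e v • x v‖ ^ 2 = β * (∑ v ∈ T, e v) ^ 2 + (1 - β) * ∑ v ∈ T, e v ^ 2 := by
  have h : ∀ u ∈ T, ∑ v ∈ T, ⟪e u • x u, e v • x v⟫ =
      β * (e u * ∑ v ∈ T, e v) + (1 - β) * e u ^ 2 := by
    intro u hu
    rw [← Finset.add_sum_erase T _ hu, ← Finset.add_sum_erase T e hu, mul_add (e u), Finset.mul_sum,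
      mul_add, Finset.mul_sum, real_inner_smul_left, real_inner_smul_right, h1 u hu]
    have : ∀ v ∈ T.erase u, ⟪e u • x u, e v • x v⟫ = β * (e u * e v) := fun v hv => by
      rw [real_inner_smul_left, real_inner_smul_right,
        hT u hu v (Finset.mem_of_mem_erase hv) (Finset.ne_of_mem_erase hv).symm]
      ring
    rw [Finset.sum_congr rfl this]
    ring
  rw [← real_inner_self_eq_norm_sq, sum_inner]
  simp_rw [inner_sum]
  rw [Finset.sum_congr rfl h, Finset.sum_add_distrib, ← Finset.mul_sum, ← Finset.sum_mul,
    ← Finset.mul_sum, sq]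

/-- Unit vectors with pairwise inner products `-α` are few. -/
theorem card_mul_le_of_pairwise_inner_neg (x : V → E) (α : ℝ) (hα : 0 ≤ α) (T : Finset V)
    (h1 : ∀ v ∈ T, ⟪x v, x v⟫ = 1) (hT : ∀ u ∈ T, ∀ v ∈ T, u ≠ v → ⟪x u, x v⟫ = -α) :
    (T.card : ℝ) * α ≤ 1 + α := by
  have h := norm_sq_sum_smul_of_pairwise_inner x (-α) T h1 hT fun _ => 1
  simp only [Finset.sum_const, one_pow, nsmul_eq_mul, mul_one] at h
  have h2 := sq_nonneg ‖∑ v ∈ T, (1 : ℝ) • x v‖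
  rw [h] at h2
  rcases T.card.eq_zero_or_pos with h0 | h0
  · simp only [h0, Nat.cast_zero, zero_mul]
    linarith
  · have : (0 : ℝ) < T.card := by exact_mod_cast h0
    by_contra hlt
    nlinarith

/-- A unit vector cannot have inner product `-α` with many, and `α` with many, unit vectors of
pairwise inner product `α`. -/
theorem card_mul_sq_le_of_split (x : V → E) (α : ℝ) (hα : 0 < α) (T : Finset V)
    (h1 : ∀ v ∈ T, ⟪x v, x v⟫ = 1) (hT : ∀ u ∈ T, ∀ v ∈ T, u ≠ v → ⟪x u, x v⟫ = α) (y : E)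
    (hy : ‖y‖ = 1) (Y J : Finset V) (hYT : Y ⊆ T) (hJT : J ⊆ T) (m : ℕ) (hm : 0 < m)
    (hYm : Y.card = m) (hJm : J.card = m) (hY : ∀ v ∈ Y, ⟪y, x v⟫ = -α)
    (hJ : ∀ v ∈ J, ⟪y, x v⟫ = α) : 2 * (m : ℝ) * α ^ 2 ≤ 1 - α := by
  have hdisj : Disjoint Y J := Finset.disjoint_left.2 fun v hv hv' => by
    linarith [hY v hv, hJ v hv']
  have hsub : Y ∪ J ⊆ T := Finset.union_subset hYT hJT
  -- With these signs the coefficients cancel in the rank-one part of the norm, while all products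
  -- with y add up; Cauchy–Schwarz then bounds m.
  let e : V → ℝ := fun v => if v ∈ J then 1 else -1
  have heJ : ∀ v ∈ J, e v = 1 := fun v hv => if_pos hv
  have heY : ∀ v ∈ Y, e v = -1 := fun v hv => if_neg (Finset.disjoint_left.1 hdisj hv)
  have h := norm_sq_sum_smul_of_pairwise_inner x α (Y ∪ J) (fun v hv => h1 v (hsub hv))
    (fun u hu v hv => hT u (hsub hu) v (hsub hv)) e
  have hs1 : ∑ v ∈ Y ∪ J, e v = 0 := by
    rw [Finset.sum_union hdisj, Finset.sum_congr rfl heY, Finset.sum_congr rfl heJ]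
    simp [hYm, hJm]
  have hs2 : ∑ v ∈ Y ∪ J, e v ^ 2 = 2 * m := by
    have : ∀ v ∈ Y ∪ J, e v ^ 2 = 1 := fun v _ => by simp only [e]; split_ifs <;> norm_num
    rw [Finset.sum_congr rfl this]
    simp [Finset.card_union_of_disjoint hdisj, hYm, hJm, two_mul]
  have hYe : ∀ v ∈ Y, ⟪y, e v • x v⟫ = α := fun v hv => by
    rw [real_inner_smul_right, heY v hv, hY v hv]; ring
  have hJe : ∀ v ∈ J, ⟪y, e v • x v⟫ = α := fun v hv => by
    rw [real_inner_smul_right, heJ v hv, hJ v hv, one_mul]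
  have hin : ⟪y, ∑ v ∈ Y ∪ J, e v • x v⟫ = 2 * m * α := by
    rw [inner_sum, Finset.sum_union hdisj, Finset.sum_congr rfl hYe, Finset.sum_congr rfl hJe]
    simp only [Finset.sum_const, hYm, hJm, nsmul_eq_mul]
    ring
  rw [hs1, hs2] at h
  have hcs := abs_real_inner_le_norm y (∑ v ∈ Y ∪ J, e v • x v)
  rw [hin, hy, one_mul] at hcs
  have hm' : (0 : ℝ) < m := by exact_mod_cast hm
  have h2 : (2 * (m : ℝ) * α) ^ 2 ≤ ‖∑ v ∈ Y ∪ J, e v • x v‖ ^ 2 := sq_le_sq' (by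
    linarith [neg_abs_le (2 * (m : ℝ) * α), norm_nonneg (∑ v ∈ Y ∪ J, e v • x v),
      le_abs_self (2 * (m : ℝ) * α), mul_pos (mul_pos two_pos hm') hα]) ((le_abs_self _).trans hcs)
  rw [h] at h2
  have h3 : 2 * (m : ℝ) * (2 * m * α ^ 2) ≤ 2 * m * (1 - α) := by nlinarith
  exact le_of_mul_le_mul_left h3 (by positivity)

end Switching

/-! ### Switching to bounded degree -/

section BoundedDegree

open scoped Classical RealInnerProductSpace
open Matrix

/-- The graph joining the indices of vectors with negative inner product. -/
def negativeGraph {E : Type*} [NormedAddCommGroup E] [InnerProductSpace ℝ E] {V : Type*}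
    (x : V → E) : SimpleGraph V where
  Adj u v := u ≠ v ∧ ⟪x u, x v⟫ < 0
  symm := ⟨fun _ _ h => ⟨h.1.symm, by rw [real_inner_comm]; exact h.2⟩⟩
  loopless := ⟨fun _ h => h.1 rfl⟩

/-- Unit vectors spanning equiangular lines can be chosen so that each has negative inner product
with boundedly many others, unless there are few lines. -/
theorem exists_switching_bounded_degree (k : ℕ) (hk : 2 ≤ k) :
    ∃ D : ℕ, ∀ (V E : Type) [Fintype V] [NormedAddCommGroup E] [InnerProductSpace ℝ E] (x : V → E),
      (∀ v, ‖x v‖ = 1) →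
      (∀ u v, u ≠ v → ⟪x u, x v⟫ = 1 / (2 * (k : ℝ) - 1) ∨ ⟪x u, x v⟫ = -(1 / (2 * (k : ℝ) - 1))) →
      Fintype.card V ≤ D ∨ ∃ σ : V → ℝ, (∀ v, σ v = 1 ∨ σ v = -1) ∧
        ∀ v, (Finset.univ.filter ((negativeGraph fun v => σ v • x v).Adj v)).card ≤ D := by
  have hk' : (2 : ℝ) ≤ k := by exact_mod_cast hk
  set α : ℝ := 1 / (2 * (k : ℝ) - 1) with hα
  have hden : 0 < 2 * (k : ℝ) - 1 := by linarith
  have hαpos : 0 < α := by positivity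
  have hαk : α * (2 * k - 1) = 1 := by rw [hα]; field_simp
  -- Then m α² = (1 + α)² > 1, against the bound 2 m α² ≤ 1 - α for a split clique.
  set m : ℕ := 4 * k ^ 2 with hm
  have hmpos : 0 < m := by positivity
  have hmα : 1 < (m : ℝ) * α ^ 2 := by
    have h1 : (m : ℝ) * α ^ 2 = (α * (2 * k - 1) + α) ^ 2 := by rw [hm]; push_cast; ring
    rw [h1, hαk]
    nlinarith
  -- The set `bad` below has at most m² + 2m + 1 elements, so m members of the clique survive its
  -- removal.
  set L : ℕ := m * m + 3 * m + 1 with hL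
  have hmL : m ≤ L := by nlinarith
  refine ⟨2 ^ (2 * k + 1 + L), fun V E _ _ _ x hx1 hxα => ?_⟩
  -- Ramsey's theorem for every switching of the vectors
  have hram : ∀ (y : V → E), (∀ v, ‖y v‖ = 1) →
      (∀ u v, u ≠ v → ⟪y u, y v⟫ = α ∨ ⟪y u, y v⟫ = -α) → ∀ (b : ℕ) (s : Finset V),
      2 ^ (2 * k + 1 + b) ≤ s.card →
      ∃ t ⊆ s, t.card = b ∧ ∀ u ∈ t, ∀ v ∈ t, u ≠ v → ⟪y u, y v⟫ = α := by
    intro y hy1 hyα b s hs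
    -- A negative clique of size 2k + 1 would give 2kα ≤ 1, but 2kα = 1 + α.
    rcases exists_clique_or_independent (negativeGraph y) (2 * k + 1) b s hs with
      ⟨t, -, htc, ht⟩ | ⟨t, hts, htc, ht⟩
    · exfalso
      have h2 := card_mul_le_of_pairwise_inner_neg y α hαpos.le t
        (fun v _ => by rw [real_inner_self_eq_norm_sq, hy1, one_pow]) fun u hu v hv huv =>
          (hyα u v huv).resolve_left fun h => by
            have h3 := (ht u hu v hv huv).2
            linarith
      rw [htc] at h2
      push_cast at h2
      nlinarith
    · refine ⟨t, hts, htc, fun u hu v hv huv => (hyα u v huv).resolve_right fun h => ?_⟩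
      exact ht u hu v hv huv ⟨huv, by rw [h]; linarith⟩
  rcases Nat.lt_or_ge (Fintype.card V) (2 ^ (2 * k + 1 + L)) with hV | hV
  · exact Or.inl hV.le
  right
  obtain ⟨I, -, hIcard, hI⟩ := hram x hx1 hxα L Finset.univ (by rwa [Finset.card_univ])
  -- Flip the vectors outside the positive clique `I` that are negative on at least m of its
  -- members. No vector is negative on m and positive on m of them, so afterwards each is negative
  -- on at most m.
  let σ : V → ℝ := fun v =>
    if v ∉ I ∧ m ≤ (I.filter fun i => ⟪x v, x i⟫ < 0).card then -1 else 1
  have hσ : ∀ v, σ v = 1 ∨ σ v = -1 := fun v => by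
    by_cases h : v ∉ I ∧ m ≤ (I.filter fun i => ⟪x v, x i⟫ < 0).card
    · exact Or.inr (if_pos h)
    · exact Or.inl (if_neg h)
  have hσI : ∀ v ∈ I, σ v = 1 := fun v hv => if_neg fun h => h.1 hv
  refine ⟨σ, hσ, ?_⟩
  set y : V → E := fun v => σ v • x v with hy
  have hy1 : ∀ v, ‖y v‖ = 1 := fun v => by
    rcases hσ v with h | h <;> simp [hy, h, hx1]
  have hyy : ∀ v, ⟪y v, y v⟫ = 1 := fun v => by
    rw [real_inner_self_eq_norm_sq, hy1, one_pow]
  have hyα : ∀ u v, u ≠ v → ⟪y u, y v⟫ = α ∨ ⟪y u, y v⟫ = -α := fun u v huv => by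
    rcases hσ u with h | h <;> rcases hσ v with h' | h' <;> rcases hxα u v huv with h'' | h'' <;>
      simp [hy, h, h', h'']
  have hyI : ∀ i ∈ I, y i = x i := fun i hi => by simp [hy, hσI i hi]
  have hIα : ∀ u ∈ I, ∀ v ∈ I, u ≠ v → ⟪y u, y v⟫ = α := fun u hu v hv huv => by
    rw [hyI u hu, hyI v hv]
    exact hI u hu v hv huv
  -- a unit vector cannot be negative on `m` and positive on `m` members of a positive clique
  have hsplit : ∀ (z : V → E), (∀ v, ‖z v‖ = 1) →
      (∀ u v, u ≠ v → ⟪z u, z v⟫ = α ∨ ⟪z u, z v⟫ = -α) → ∀ (T : Finset V),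
      (∀ u ∈ T, ∀ v ∈ T, u ≠ v → ⟪z u, z v⟫ = α) → ∀ (v : V) (Y J : Finset V), Y ⊆ T → J ⊆ T →
      m ≤ Y.card → m ≤ J.card → (∀ u ∈ Y, v ≠ u ∧ ⟪z v, z u⟫ < 0) →
      (∀ u ∈ J, v ≠ u ∧ ¬⟪z v, z u⟫ < 0) → False := by
    intro z hz1 hzα T hT v Y J hYT hJT hYc hJc hY hJ
    obtain ⟨Y', hY', hY'c⟩ := Finset.exists_subset_card_eq hYc
    obtain ⟨J', hJ', hJ'c⟩ := Finset.exists_subset_card_eq hJc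
    have h := card_mul_sq_le_of_split z α hαpos T
      (fun v _ => by rw [real_inner_self_eq_norm_sq, hz1, one_pow]) hT (z v) (hz1 v) Y' J'
      (hY'.trans hYT) (hJ'.trans hJT) m hmpos hY'c hJ'c
      (fun u hu => (hzα v u (hY u (hY' hu)).1).resolve_left fun h => by
        linarith [(hY u (hY' hu)).2])
      (fun u hu => (hzα v u (hJ u (hJ' hu)).1).resolve_right fun h =>
        (hJ u (hJ' hu)).2 (by linarith))
    nlinarith
  have hneg : ∀ v, (I.filter fun i => v ≠ i ∧ ⟪y v, y i⟫ < 0).card ≤ m := by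
    intro v
    by_cases hvI : v ∈ I
    · rw [Finset.filter_false_of_mem]
      · simp
      · rintro i hi ⟨hne, hlt⟩
        rw [hIα v hvI i hi hne] at hlt
        linarith
    have hne : ∀ i ∈ I, v ≠ i := fun i hi h => hvI (h ▸ hi)
    by_cases hc : m ≤ (I.filter fun i => ⟪x v, x i⟫ < 0).card
    · have hσv : σ v = -1 := if_pos ⟨hvI, hc⟩
      by_contra hcon
      refine hsplit x hx1 hxα I hI v (I.filter fun i => ⟪x v, x i⟫ < 0)
        (I.filter fun i => v ≠ i ∧ ⟪y v, y i⟫ < 0) (Finset.filter_subset _ _)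
        (Finset.filter_subset _ _) hc (by omega) (fun u hu => ?_) (fun u hu => ?_)
      · rw [Finset.mem_filter] at hu
        exact ⟨hne u hu.1, hu.2⟩
      · rw [Finset.mem_filter] at hu
        have h2 := hu.2.2
        rw [hyI u hu.1, hy] at h2
        simp only [hσv, neg_smul, one_smul, inner_neg_left] at h2
        exact ⟨hu.2.1, by linarith⟩
    · have hσv : σ v = 1 := if_neg fun h => hc h.2
      refine (Finset.card_le_card fun i hi => ?_).trans (not_le.1 hc).le
      rw [Finset.mem_filter] at hi ⊢
      have h2 := hi.2.2
      rw [hyI i hi.1, hy] at h2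
      simp only [hσv, one_smul] at h2
      exact ⟨hi.1, h2⟩
  intro v
  by_contra hdeg
  -- A vertex of large negative degree has a positive clique `Y` among its neighbours. Joined to the
  -- members of `I` that are positive against v and `Y`, it forms a positive clique split by v.
  obtain ⟨Y, hYN, hYc, hYα⟩ := hram y hy1 hyα m
    (Finset.univ.filter ((negativeGraph y).Adj v))
    ((Nat.pow_le_pow_right two_pos (by omega)).trans (not_le.1 hdeg).le)
  have hYv : ∀ u ∈ Y, v ≠ u ∧ ⟪y v, y u⟫ < 0 := fun u hu => (Finset.mem_filter.1 (hYN hu)).2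
  let bad : Finset V := insert v Y ∪ ((I.filter fun i => v ≠ i ∧ ⟪y v, y i⟫ < 0) ∪
    Y.biUnion fun u => I.filter fun i => u ≠ i ∧ ⟪y u, y i⟫ < 0)
  have hbad : bad.card ≤ (m + 1) + (m + m * m) := by
    refine (Finset.card_union_le _ _).trans (Nat.add_le_add ?_ ?_)
    · exact (Finset.card_insert_le _ _).trans (by rw [hYc])
    · refine (Finset.card_union_le _ _).trans (Nat.add_le_add (hneg v) ?_)
      have := Finset.card_biUnion_le_card_mul Y
        (fun u => I.filter fun i => u ≠ i ∧ ⟪y u, y i⟫ < 0) m fun u _ => hneg u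
      rwa [hYc] at this
  have hJc : m ≤ (I \ bad).card := by
    have := Finset.le_card_sdiff bad I
    omega
  have hJ : ∀ i ∈ I \ bad, i ∈ I ∧ v ≠ i ∧ ¬⟪y v, y i⟫ < 0 ∧ ∀ u ∈ Y, u ≠ i ∧ ⟪y u, y i⟫ = α := by
    intro i hi
    rw [Finset.mem_sdiff] at hi
    obtain ⟨hiI, hib⟩ := hi
    simp only [bad, Finset.mem_union, Finset.mem_insert, Finset.mem_filter, Finset.mem_biUnion,
      not_or, not_and, not_exists] at hib
    obtain ⟨⟨h1, h2⟩, h3, h4⟩ := hib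
    refine ⟨hiI, fun h => h1 h.symm, h3 hiI fun h => h1 h.symm, fun u hu => ?_⟩
    have hui : u ≠ i := fun h => h2 (h ▸ hu)
    exact ⟨hui, (hyα u i hui).resolve_right fun h => h4 u hu hiI hui (by linarith)⟩
  refine hsplit y hy1 hyα (Y ∪ I \ bad) ?_ v Y (I \ bad) Finset.subset_union_left
    Finset.subset_union_right hYc.ge hJc hYv fun u hu => ⟨(hJ u hu).2.1, (hJ u hu).2.2.1⟩
  intro u hu w hw huw
  rcases Finset.mem_union.1 hu with hu | hu <;> rcases Finset.mem_union.1 hw with hw | hw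
  · exact hYα u hu w hw huw
  · exact ((hJ w hw).2.2.2 u hu).2
  · rw [real_inner_comm]
    exact ((hJ u hu).2.2.2 w hw).2
  · exact hIα u (hJ u hu).1 w (hJ w hw).1 huw

end BoundedDegree

/-! ### The upper bound from the corank -/

section UpperBound

open scoped Classical RealInnerProductSpace
open Matrix

/-- The Gram matrix of unit vectors with inner products `±1 / (2 k - 1)` is a multiple of
`(k - 1) I - A + J / 2`. -/
theorem inner_sum_smul_eq {E : Type*} [NormedAddCommGroup E] [InnerProductSpace ℝ E] {V : Type*}
    [Fintype V] (k : ℕ) (hk : 2 ≤ k) (x : V → E) (hx1 : ∀ v, ‖x v‖ = 1)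
    (hxα : ∀ u v, u ≠ v →
      ⟪x u, x v⟫ = 1 / (2 * (k : ℝ) - 1) ∨ ⟪x u, x v⟫ = -(1 / (2 * (k : ℝ) - 1)))
    (e : V → ℝ) (v : V) :
    ⟪x v, ∑ u, e u • x u⟫ = 2 * (1 / (2 * (k : ℝ) - 1)) * (((k : ℝ) - 1) * e v -
      ((negativeGraph x).adjMatrix ℝ *ᵥ e) v + (∑ u, e u) / 2) := by
  have hk' : (2 : ℝ) ≤ k := by exact_mod_cast hk
  have hden : 0 < 2 * (k : ℝ) - 1 := by linarith
  have hαpos : 0 < 1 / (2 * (k : ℝ) - 1) := by positivity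
  have hterm : ∀ u, ⟪x v, e u • x u⟫ = 2 * (1 / (2 * (k : ℝ) - 1)) *
      (((k : ℝ) - 1) * (if u = v then e u else 0) - (negativeGraph x).adjMatrix ℝ v u * e u +
        e u / 2) := by
    intro u
    rw [real_inner_smul_right]
    by_cases huv : u = v
    · subst huv
      rw [real_inner_self_eq_norm_sq, hx1, SimpleGraph.adjMatrix_apply,
        if_neg ((negativeGraph x).irrefl), if_pos rfl]
      field_simp
      ring
    · rw [if_neg huv, SimpleGraph.adjMatrix_apply]
      rcases hxα v u (Ne.symm huv) with h | h
      · rw [if_neg fun hadj => by linarith [hadj.2], h]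
        ring
      · rw [if_pos ⟨Ne.symm huv, by linarith⟩, h]
        ring
  rw [inner_sum, Finset.sum_congr rfl fun u _ => hterm u, ← Finset.mul_sum, Finset.sum_add_distrib,
    Finset.sum_sub_distrib, ← Finset.mul_sum, Finset.sum_ite_eq', if_pos (Finset.mem_univ v),
    ← Finset.sum_div]
  rfl

/-- The kernel of e ↦ ∑ e u • x u lies in the kernel of M, so n ≤ d + corank. Corank at most n/k - 1
gives the exact bound; the other two cases are weaker for large d. -/
theorem card_le_of_bounded_degree (k : ℕ) (hk : 2 ≤ k) (Δ : ℕ) :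
    ∃ d₀ : ℕ, ∀ d : ℕ, d₀ ≤ d → ∀ (V : Type) [Fintype V] (x : V → EuclideanSpace ℝ (Fin d)),
      (∀ v, ‖x v‖ = 1) →
      (∀ u v, u ≠ v → ⟪x u, x v⟫ = 1 / (2 * (k : ℝ) - 1) ∨ ⟪x u, x v⟫ = -(1 / (2 * (k : ℝ) - 1))) →
      (∀ v, (Finset.univ.filter ((negativeGraph x).Adj v)).card ≤ Δ) →
      (Fintype.card V : ℝ) ≤ (k : ℝ) / ((k : ℝ) - 1) * ((d : ℝ) - 1) := by
  have hk' : (2 : ℝ) ≤ k := by exact_mod_cast hk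
  have hk1 : 0 < (k : ℝ) - 1 := by linarith
  have hden : 0 < 2 * (k : ℝ) - 1 := by linarith
  obtain ⟨B, hB, hcorank⟩ := exists_corank_bound k hk Δ
  refine ⟨max k ⌈2 * ((k : ℝ) - 1) * B + 2 * k⌉₊, fun d hd V _ x hx1 hxα hΔ => ?_⟩
  have hdk : (k : ℝ) ≤ d := by exact_mod_cast (le_max_left _ _).trans hd
  have hdB : 2 * ((k : ℝ) - 1) * B + 2 * k ≤ d :=
    (Nat.le_ceil _).trans (by exact_mod_cast (le_max_right _ _).trans hd)
  have hgram := inner_sum_smul_eq k hk x hx1 hxα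
  let f : (V → ℝ) →ₗ[ℝ] EuclideanSpace ℝ (Fin d) := Fintype.linearCombination ℝ x
  have hf : ∀ e, f e = ∑ u, e u • x u := fun e => Fintype.linearCombination_apply ℝ x e
  have hM : ∀ e : V → ℝ, 0 ≤ quadForm (negativeGraph x) ((k : ℝ) - 1) e + (∑ v, e v) ^ 2 / 2 := by
    intro e
    have h1 : ⟪f e, f e⟫ = 2 * (1 / (2 * (k : ℝ) - 1)) *
        (quadForm (negativeGraph x) ((k : ℝ) - 1) e + (∑ v, e v) ^ 2 / 2) := by
      conv_lhs => rw [hf e, sum_inner]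
      simp_rw [real_inner_smul_left, hgram e]
      rw [quadForm_eq_sum, sq, mul_div_assoc, Finset.sum_mul, ← Finset.sum_add_distrib,
        Finset.mul_sum]
      exact Finset.sum_congr rfl fun v _ => by ring
    have h2 : 0 ≤ ⟪f e, f e⟫ := real_inner_self_nonneg
    rw [h1] at h2
    exact nonneg_of_mul_nonneg_right h2 (by positivity)
  have hrank : Fintype.card V ≤ d + Module.finrank ℝ (LinearMap.ker f) := by
    have h1 := LinearMap.finrank_range_add_finrank_ker f
    have h2 := Submodule.finrank_le (LinearMap.range f)
    rw [Module.finrank_fintype_fun_eq_card] at h1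
    rw [finrank_euclideanSpace_fin] at h2
    omega
  have hrank' : (Fintype.card V : ℝ) ≤ d + Module.finrank ℝ (LinearMap.ker f) := by
    exact_mod_cast hrank
  rw [div_mul_eq_mul_div, le_div_iff₀ hk1]
  rcases hcorank V (negativeGraph x) hΔ hM (LinearMap.ker f) (fun e he v => by
    have h1 := hgram e v
    rw [← hf, LinearMap.mem_ker.1 he, inner_zero_right] at h1
    exact (mul_eq_zero.1 h1.symm).resolve_left (by positivity)) with h | h | h
  · rw [h] at hrank'
    push_cast at hrank'
    nlinarith
  · have h' : (k : ℝ) * (Module.finrank ℝ (LinearMap.ker f) + 1) ≤ Fintype.card V := by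
      exact_mod_cast h
    nlinarith
  · have h1 : (Fintype.card V : ℝ) ≤ d + (Fintype.card V / (2 * k) + B) := by linarith
    have h2 : (Fintype.card V : ℝ) / (2 * k) * (2 * k) = Fintype.card V := by field_simp
    have h3 : (Fintype.card V : ℝ) * (2 * k - 1) ≤ 2 * k * (d + B) := by nlinarith
    have h4 : (Fintype.card V : ℝ) * (2 * k - 1) * (k - 1) ≤ 2 * k * (d + B) * (k - 1) :=
      mul_le_mul_of_nonneg_right h3 hk1.le
    -- This is d ≥ 2(k-1)B + 2k - 1, the source of the threshold on d; it works because 2k/(2k-1) <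
    -- k/(k-1).
    have h5 : 2 * (d + B) * ((k : ℝ) - 1) ≤ (2 * k - 1) * (d - 1) := by nlinarith
    have h6 := mul_le_mul_of_nonneg_left h5 (show (0 : ℝ) ≤ k by linarith)
    refine le_of_mul_le_mul_right ?_ hden
    linarith

theorem card_le_of_equiangular (k : ℕ) (hk : 2 ≤ k) :
    ∃ d₀ : ℕ, ∀ d : ℕ, d₀ ≤ d → ∀ (V : Type) [Fintype V] (x : V → EuclideanSpace ℝ (Fin d)),
      (∀ v, ‖x v‖ = 1) →
      (∀ u v, u ≠ v → ⟪x u, x v⟫ = 1 / (2 * (k : ℝ) - 1) ∨ ⟪x u, x v⟫ = -(1 / (2 * (k : ℝ) - 1))) →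
      (Fintype.card V : ℝ) ≤ (k : ℝ) / ((k : ℝ) - 1) * ((d : ℝ) - 1) := by
  have hk' : (2 : ℝ) ≤ k := by exact_mod_cast hk
  have hk1 : 0 < (k : ℝ) - 1 := by linarith
  obtain ⟨D, hD⟩ := exists_switching_bounded_degree k hk
  obtain ⟨d₁, hd₁⟩ := card_le_of_bounded_degree k hk D
  refine ⟨max d₁ (max D k), fun d hd V _ x hx1 hxα => ?_⟩
  rcases hD V _ x hx1 hxα with h | ⟨σ, hσ, hdeg⟩
  · have hVd : (Fintype.card V : ℝ) ≤ d := by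
      exact_mod_cast h.trans ((le_max_left D k).trans ((le_max_right _ _).trans hd))
    have hdk : (k : ℝ) ≤ d := by
      exact_mod_cast (le_max_right D k).trans ((le_max_right _ _).trans hd)
    rw [div_mul_eq_mul_div, le_div_iff₀ hk1]
    nlinarith
  · refine hd₁ d ((le_max_left _ _).trans hd) V (fun v => σ v • x v) (fun v => ?_)
      (fun u v huv => ?_) hdeg
    · rcases hσ v with h | h <;> simp [h, hx1]
    · rcases hσ u with h | h <;> rcases hσ v with h' | h' <;> rcases hxα u v huv with h'' | h'' <;>
        simp only [h, h', h'', one_smul, neg_smul, inner_neg_left, inner_neg_right, neg_neg,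
          true_or, or_true]

end UpperBound

/-! ### From vectors to lines, and the extremal configuration -/

section Lines

open scoped RealInnerProductSpace
open Matrix

theorem min_arccos_eq_arccos {α t : ℝ} (hα : 0 ≤ α) (h : t = α ∨ t = -α) :
    min (Real.arccos t) (Real.pi - Real.arccos t) = Real.arccos α := by
  have h1 : Real.arccos α ≤ Real.pi / 2 := Real.arccos_le_pi_div_two.2 hα
  rcases h with rfl | rfl
  · exact min_eq_left (by linarith)
  · rw [Real.arccos_neg, sub_sub_cancel]
    exact min_eq_right (by linarith)

theorem eq_or_eq_neg_of_min_arccos {α t : ℝ} (hα : 0 ≤ α) (hα1 : α ≤ 1) (ht : |t| ≤ 1)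
    (h : min (Real.arccos t) (Real.pi - Real.arccos t) = Real.arccos α) : t = α ∨ t = -α := by
  have ht' := abs_le.1 ht
  rcases min_choice (Real.arccos t) (Real.pi - Real.arccos t) with h1 | h1
  · rw [h1] at h
    exact Or.inl (Real.arccos_injOn ⟨ht'.1, ht'.2⟩ ⟨by linarith, hα1⟩ h)
  · rw [h1, ← Real.arccos_neg] at h
    have := Real.arccos_injOn (x₁ := -t) (x₂ := α) ⟨by linarith, by linarith⟩ ⟨by linarith, hα1⟩ h
    exact Or.inr (by linarith)

theorem lineAngle_eq_min_arccos {d : ℕ} (l m : OriginLine d) :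
    lineAngle l m = min (Real.arccos ⟪‖l.rep‖⁻¹ • l.rep, ‖m.rep‖⁻¹ • m.rep⟫)
      (Real.pi - Real.arccos ⟪‖l.rep‖⁻¹ • l.rep, ‖m.rep‖⁻¹ • m.rep⟫) := by
  have : ⟪‖l.rep‖⁻¹ • l.rep, ‖m.rep‖⁻¹ • m.rep⟫ = ⟪l.rep, m.rep⟫ / (‖l.rep‖ * ‖m.rep‖) := by
    rw [real_inner_smul_left, real_inner_smul_right]
    field_simp
  rw [this]
  rfl

/-- Vectors of equal length with proportionally constant absolute inner products span equiangular
lines. -/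
theorem card_le_maxEquiangular {V κ : Type*} [Fintype V] [Fintype κ] (d : ℕ)
    (hd : Fintype.card κ = d) (α : ℝ) (hα : 0 ≤ α) (hα1 : α < 1) (c : ℝ) (hc : 0 < c)
    (y : V → κ → ℝ) (hdiag : ∀ v, y v ⬝ᵥ y v = c)
    (hoff : ∀ u v, u ≠ v → y u ⬝ᵥ y v = c * α ∨ y u ⬝ᵥ y v = c * -α) :
    (Fintype.card V : ℕ∞) ≤ maxEquiangular α d := by
  let e : Fin d ≃ κ := (Fintype.equivFinOfCardEq hd).symm
  let x : V → EuclideanSpace ℝ (Fin d) := fun v => WithLp.toLp 2 (y v ∘ e)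
  have hinner : ∀ u v, ⟪x u, x v⟫ = y u ⬝ᵥ y v := by
    intro u v
    rw [dotProduct_comm, PiLp.inner_apply]
    exact Fintype.sum_equiv e _ _ fun i => rfl
  have hnorm : ∀ v, ‖x v‖ * ‖x v‖ = c := fun v => by
    rw [← real_inner_self_eq_norm_mul_norm, hinner, hdiag]
  have hnorm_eq : ∀ u v, ‖x u‖ * ‖x v‖ = c := fun u v => by
    have : ‖x u‖ = ‖x v‖ := by
      rw [← mul_self_inj (norm_nonneg _) (norm_nonneg _), hnorm, hnorm]
    rw [this, hnorm]
  have hx0 : ∀ v, x v ≠ 0 := fun v h => by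
    have := hnorm v
    rw [h, norm_zero, zero_mul] at this
    exact hc.ne this
  let l : V → OriginLine d := fun v => Projectivization.mk ℝ (x v) (hx0 v)
  have hangle : ∀ u v, u ≠ v → lineAngle (l u) (l v) = Real.arccos α := by
    intro u v huv
    rw [lineAngle_mk]
    refine min_arccos_eq_arccos hα ?_
    rw [hinner, hnorm_eq]
    exact (hoff u v huv).imp (fun h => by rw [h]; field_simp) fun h => by rw [h]; field_simp
  have hinj : Function.Injective l := by
    intro u v huv
    by_contra hne
    have h1 := hangle u v hne
    rw [huv, lineAngle_mk, InnerProductGeometry.angle_self (hx0 v), sub_zero,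
      min_eq_left Real.pi_pos.le] at h1
    have h2 := Real.arccos_pos.2 hα1
    linarith
  have heq : IsEquiangular α (Set.range l) := by
    rintro _ ⟨u, rfl⟩ _ ⟨v, rfl⟩ hne
    exact hangle u v fun h => hne (h ▸ rfl)
  have hcard : (Set.range l).encard = Fintype.card V := by
    rw [← Set.image_univ, hinj.encard_image, Set.encard_univ, ENat.card_eq_coe_fintype_card]
  exact hcard ▸ le_iSup₂_of_le (Set.range l) heq le_rfl

/-- The regular simplex with `m + 1` vertices in dimension `m`, centred at the origin. -/
theorem exists_regular_simplex (m : ℕ) (hm : 0 < m) :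
    ∃ f : Fin (m + 1) → Fin m → ℝ, ∀ i j, f i ⬝ᵥ f j = if i = j then (m : ℝ) else -1 := by
  have hm' : (0 : ℝ) < m := by exact_mod_cast hm
  set r : ℝ := Real.sqrt (m + 1) with hr
  have hr2 : r ^ 2 = m + 1 := Real.sq_sqrt (by positivity)
  -- The vertices are (-1, ..., -1) and r eᵢ - t(1, ..., 1). This t makes the latter have coordinate
  -- sum 1, hence product -1 with the former; r² = m + 1 settles the rest.
  set t : ℝ := (r - 1) / m with ht
  have htm : t * m = r - 1 := by rw [ht]; field_simp
  have ht2 : t * (r - 1) - 2 * r * t = -1 := by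
    have : (t * (r - 1) - 2 * r * t) * m = -1 * m := by
      calc (t * (r - 1) - 2 * r * t) * m = (t * m) * (r - 1) - 2 * r * (t * m) := by ring
        _ = -1 * m := by rw [htm]; nlinarith
    exact mul_right_cancel₀ hm'.ne' this
  let g : Fin m → Fin m → ℝ := fun i c => r * (if c = i then 1 else 0) - t
  let f : Fin (m + 1) → Fin m → ℝ := Fin.lastCases (fun _ => -1) g
  have hflast : f (Fin.last m) = fun _ => -1 := Fin.lastCases_last ..
  have hfcast : ∀ i : Fin m, f i.castSucc = g i := fun i => Fin.lastCases_castSucc ..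
  have hsum : ∀ i, ∑ c, g i c = 1 := fun i => by
    simp only [g, Finset.sum_sub_distrib, ← Finset.mul_sum, Finset.sum_ite_eq', Finset.mem_univ,
      if_true, Finset.sum_const, Finset.card_univ, Fintype.card_fin, nsmul_eq_mul]
    linarith
  have hgg : ∀ i j, g i ⬝ᵥ g j = if i = j then (m : ℝ) else -1 := by
    intro i j
    have h1 : g i ⬝ᵥ g j = ∑ c, (r * (if c = i then g j c else 0) - t * g j c) :=
      Finset.sum_congr rfl fun c _ => by simp only [g]; split_ifs <;> ring
    rw [h1, Finset.sum_sub_distrib, ← Finset.mul_sum, ← Finset.mul_sum, hsum, Finset.sum_ite_eq',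
      if_pos (Finset.mem_univ i)]
    simp only [g]
    split_ifs <;> nlinarith
  refine ⟨f, fun i j => ?_⟩
  induction i using Fin.lastCases with
  | last =>
    induction j using Fin.lastCases with
    | last => simp [hflast, dotProduct]
    | cast j =>
      rw [hflast, hfcast, if_neg (Fin.castSucc_lt_last j).ne']
      simp [dotProduct, hsum]
  | cast i =>
    induction j using Fin.lastCases with
    | last =>
      rw [hflast, hfcast, if_neg (Fin.castSucc_lt_last i).ne]
      simp [dotProduct, hsum]
    | cast j =>
      rw [hfcast, hfcast, hgg]
      simp

/-- Disjoint simplices and isolated vectors, all raised by the same amount, give equiangular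
lines. -/
theorem le_maxEquiangular (m q s : ℕ) (hm : 0 < m) :
    ((q * (m + 1) + s : ℕ) : ℕ∞) ≤
      maxEquiangular (1 / (2 * ((m + 1 : ℕ) : ℝ) - 1)) (1 + (q * m + s)) := by
  obtain ⟨f, hf⟩ := exists_regular_simplex m hm
  have hm' : (0 : ℝ) < m := by exact_mod_cast hm
  have hsq : √(2⁻¹ : ℝ) * √2⁻¹ = 1 / 2 := by rw [Real.mul_self_sqrt (by norm_num)]; norm_num
  have hsm : √(m : ℝ) * √m = m := Real.mul_self_sqrt hm'.le
  have hden : 0 < 2 * ((m + 1 : ℕ) : ℝ) - 1 := by push_cast; linarith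
  have hcα : ((m : ℝ) + 1 / 2) * (1 / (2 * ((m + 1 : ℕ) : ℝ) - 1)) = 1 / 2 := by
    field_simp
    push_cast
    ring
  -- The common coordinate adds 1/2 to every product: squared lengths become m + 1/2, products
  -- become 1/2 - 1 = -1/2 inside a simplex and 1/2 elsewhere.
  let y : (Fin q × Fin (m + 1)) ⊕ Fin s → Unit ⊕ ((Fin q × Fin m) ⊕ Fin s) → ℝ :=
    Sum.elim
      (fun v => Sum.elim (fun _ => √2⁻¹) (Sum.elim (fun p => if p.1 = v.1 then f v.2 p.2 else 0) 0))
      (fun v => Sum.elim (fun _ => √2⁻¹) (Sum.elim 0 fun p => if p = v then √m else 0))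
  have hll : ∀ a b, y (Sum.inl a) ⬝ᵥ y (Sum.inl b) =
      1 / 2 + if a.1 = b.1 then f a.2 ⬝ᵥ f b.2 else 0 := by
    rintro ⟨a, i⟩ ⟨b, j⟩
    simp only [y, dotProduct, Fintype.sum_sum_type, Fintype.sum_prod_type, Sum.elim_inl,
      Sum.elim_inr, Pi.zero_apply, mul_zero, Finset.sum_const_zero, add_zero, Finset.univ_unique,
      Finset.sum_singleton, hsq]
    congr 1
    rw [Finset.sum_eq_single a]
    · by_cases hab : a = b
      · simp [hab]
      · simp [hab]
    · intro c _ hc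
      simp [hc]
    · simp
  have hlr : ∀ a b, y (Sum.inl a) ⬝ᵥ y (Sum.inr b) = 1 / 2 := by
    intro a b
    simp only [y, dotProduct, Fintype.sum_sum_type, Sum.elim_inl, Sum.elim_inr, Pi.zero_apply,
      mul_zero, zero_mul, Finset.sum_const_zero, add_zero, Finset.univ_unique,
      Finset.sum_singleton, hsq]
  have hrr : ∀ a b, y (Sum.inr a) ⬝ᵥ y (Sum.inr b) = 1 / 2 + if a = b then (m : ℝ) else 0 := by
    intro a b
    simp only [y, dotProduct, Fintype.sum_sum_type, Sum.elim_inl,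
      Sum.elim_inr, Pi.zero_apply, mul_zero, Finset.sum_const_zero, zero_add, Finset.univ_unique,
      Finset.sum_singleton, hsq]
    congr 1
    rw [Finset.sum_eq_single a]
    · by_cases hab : a = b <;> simp [hab, hsm]
    · intro c _ hc
      simp [hc]
    · simp
  have h := card_le_maxEquiangular (V := (Fin q × Fin (m + 1)) ⊕ Fin s)
    (κ := Unit ⊕ ((Fin q × Fin m) ⊕ Fin s)) (1 + (q * m + s)) (by simp)
    (1 / (2 * ((m + 1 : ℕ) : ℝ) - 1)) (by positivity)
    (by rw [div_lt_one hden]; push_cast; linarith) (m + 1 / 2) (by positivity) y ?_ ?_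
  · simpa using h
  · rintro (a | a)
    · rw [hll, if_pos rfl, hf, if_pos rfl]; ring
    · rw [hrr, if_pos rfl]; ring
  · intro u v huv
    rw [mul_neg, hcα]
    rcases u with ⟨a, i⟩ | a <;> rcases v with ⟨b, j⟩ | b
    · rw [hll]
      by_cases hab : a = b
      · subst hab
        have hij : i ≠ j := fun h => huv (by rw [h])
        rw [if_pos rfl, hf, if_neg hij]
        right; norm_num
      · left; simp [hab]
    · left; exact hlr _ _
    · left; rw [dotProduct_comm]; exact hlr _ _
    · left
      have hab : a ≠ b := fun h => huv (by rw [h])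
      simp [hrr, hab]

end Lines

/-! ### The two bounds combined -/

theorem theorem2 (k : ℕ) (hk : 2 ≤ k) :
    ∃ d₀ : ℕ, ∀ d : ℕ, d₀ ≤ d →
      maxEquiangular (1 / (2 * (k : ℝ) - 1)) d =
        ((⌊(k : ℝ) / ((k : ℝ) - 1) * ((d : ℝ) - 1)⌋₊ : ℕ) : ℕ∞) := by
  have hk' : (2 : ℝ) ≤ k := by exact_mod_cast hk
  have hk1 : 0 < (k : ℝ) - 1 := by linarith
  have hden : 0 < 2 * (k : ℝ) - 1 := by linarith
  obtain ⟨d₀, hd₀⟩ := card_le_of_equiangular k hk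
  refine ⟨max d₀ 1, fun d hd => le_antisymm ?_ ?_⟩
  · refine iSup₂_le fun S hS => ?_
    by_contra hlt
    -- S may be infinite; a finite subset with one line too many already gives the contradiction.
    obtain ⟨T, hTS, hT⟩ := Set.exists_subset_encard_eq (Order.add_one_le_of_lt (not_le.1 hlt))
    have hTfin : T.Finite := Set.finite_of_encard_eq_coe (k := _ + 1) (by exact_mod_cast hT)
    let _ : Fintype T := hTfin.fintype
    have hrep : ∀ l : OriginLine d, ‖‖l.rep‖⁻¹ • l.rep‖ = 1 := fun l =>
      norm_smul_inv_norm (𝕜 := ℝ) l.rep_nonzero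
    have hcard := hd₀ d ((le_max_left _ _).trans hd) T (fun l => ‖l.1.rep‖⁻¹ • l.1.rep)
      (fun l => hrep l.1) (fun l l' hne => by
        refine eq_or_eq_neg_of_min_arccos (by positivity)
          (by rw [div_le_one hden]; linarith) ?_ ?_
        · refine (abs_real_inner_le_norm _ _).trans ?_
          rw [hrep, hrep, one_mul]
        · rw [← lineAngle_eq_min_arccos]
          exact hS (hTS l.2) (hTS l'.2) fun h => hne (Subtype.ext h))
    have h1 := Nat.le_floor hcard
    have h2 : (Fintype.card T : ℕ∞) = T.encard := by
      rw [← ENat.card_eq_coe_fintype_card]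
      rfl
    rw [hT] at h2
    have h3 : Fintype.card T = ⌊(k : ℝ) / ((k : ℝ) - 1) * ((d : ℝ) - 1)⌋₊ + 1 := by
      exact_mod_cast h2
    omega
  · obtain ⟨m, rfl⟩ : ∃ m, k = m + 1 := ⟨k - 1, by omega⟩
    obtain ⟨n, rfl⟩ : ∃ n, d = 1 + n := ⟨d - 1, by have := (le_max_right d₀ 1).trans hd; omega⟩
    have hm : 0 < m := by omega
    have hm' : (0 : ℝ) < m := by exact_mod_cast hm
    -- Using n / m simplices and n % m isolated vectors gives n + ⌊n/m⌋ lines, which is the floor of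
    -- (m + 1)n/m.
    have hdm : n / m * m + n % m = n := Nat.div_add_mod' n m
    have h := le_maxEquiangular m (n / m) (n % m) hm
    rw [hdm] at h
    refine le_trans ?_ h
    rw [Nat.cast_le, ← Nat.lt_succ_iff, Nat.floor_lt (by push_cast; simp; positivity)]
    have h1 : ((n / m : ℕ) : ℝ) * m + (n % m : ℕ) = n := by exact_mod_cast hdm
    have h2 : ((n % m : ℕ) : ℝ) < m := by exact_mod_cast Nat.mod_lt n hm
    push_cast
    rw [add_sub_cancel_right, add_sub_cancel_left, div_mul_eq_mul_div, div_lt_iff₀ hm', ← h1]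
    nlinarith
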